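/- For complex $s_1,s_2,s_3,s_4$ let $$\zeta_2((s_1,s_2,s_3,s_4);PSp(2))=\sum_{\substack{m_1,m_2\ge 1\\ m_1\equiv 1\ (\mathrm{mod}\ 2)}}\frac{1}{m_1^{s_1}m_2^{s_2}(m_1+m_2)^{s_3}(m_1+2m_2)^{s_4}},$$ and let $B_\xi(x)$ denote the Bernoulli polynomials, $\frac{te^{xt}}{e^t-1}=\sum_{\xi\ge 0}B_\xi(x)\frac{t^\xi}{\xi!}$. Let $p,q,r\ge 1$ be integers. The four series $\zeta_2((p,s,q,r);PSp(2))$, $\zeta_2((p,q,s,r);PSp(2))$, $\zeta_2((r,q,s,p);PSp(2))$, $\zeta_2((r,s,q,p);PSp(2))$ converge absolutely for $\operatorname{Re} s>1$ and, as functions of $s$, continue meromorphically to $\mathbb{C}$. With the same notation for the continued functions, $$\begin{aligned} & \zeta_2((p,s,q,r);PSp(2))+(-1)^p\zeta_2((p,q,s,r);PSp(2))\\ & \quad +(-1)^{p+q}\zeta_2((r,q,s,p);PSp(2))+(-1)^{p+q+r}\zeta_2((r,s,q,p);PSp(2))\\ & +\sum_{\xi=0}^{p} \sum_{\omega=0}^{p-\xi}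 \binom{\omega+r-1}{\omega}\binom{p+q-1-\xi-\omega}{q-1} \frac{(-1)^{p-\xi}}{2^{r+\omega}}\frac{(2\pi i)^\xi}{\xi!}\,\zeta(s+p+q+r-\xi)\frac{B_\xi(0)-B_\xi(1/2)}{2}\\ & +\sum_{\xi=0}^{q} \sum_{\omega=0}^{q-\xi} \binom{\omega+r-1}{\omega}\binom{p+q-1-\xi-\omega}{p-1} (-1)^{p-\omega}\frac{(2\pi i)^\xi}{\xi!}\,\zeta(s+p+q+r-\xi)\frac{B_\xi(0)-\left(2^{1-s-p-q-r+\xi}-1\right)B_\xi(1/2)}{2}\\ & +\sum_{\xi=0}^{r} \sum_{\omega=0}^{p-1} \binom{\omega+r-\xi}{\omega}\binom{p+q-2-\omega}{q-1} \frac{(-1)^{p}}{2^{r-\xi+\omega+1}}\frac{(2\pi i)^\xi}{\xi!}\,\zeta(s+p+q+r-\xi)\frac{B_\xi(0)-B_\xi(1/2)}{2}\\ & +\sum_{\xi=0}^{r} \sum_{\omega=0}^{q-1} \binom{\omega+r-\xi}{\omega}\binom{p+q-2-\omega}{p-1} (-1)^{p-\omega+1}\frac{(2\pi i)^\xi}{\xi!}\,\zeta(s+p+q+r-\xi)\frac{B_\xi(0)-B_\xi(1/2)}{2}=0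 \end{aligned}$$ holds for all $s\in\mathbb{C}$ except for singularities of the functions involved, that is, at every $s$ at which the four continued functions and the explicit combination of values of the Riemann zeta-function are holomorphic. -/

import Mathlib

/-- The pairs `(m₁, m₂)` of positive integers with `m₁ ≡ 1 (mod 2)`. -/
abbrev PSp2Index : Type := {m : ℕ+ × ℕ+ // (m.1 : ℕ) ≡ 1 [MOD 2]}

/-- The general term of `ζ₂(s; PSp(2))`, that is
`m₁ ^ (-s₁) m₂ ^ (-s₂) (m₁ + m₂) ^ (-s₃) (m₁ + 2 m₂) ^ (-s₄)`. -/
noncomputable def zetaPSp2Term (s₁ s₂ s₃ s₄ : ℂ) (m : PSp2Index) : ℂ :=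
  1 / ((m.1.1 : ℂ) ^ s₁ * (m.1.2 : ℂ) ^ s₂ * ((m.1.1 : ℂ) + (m.1.2 : ℂ)) ^ s₃ *
    ((m.1.1 : ℂ) + 2 * (m.1.2 : ℂ)) ^ s₄)

/-- `F` is the meromorphic continuation to `ℂ` of the function `s ↦ ∑ₘ u s m`: it is meromorphic
on `ℂ`, and on the half plane `1 < Re s` the series converges (absolutely) to `F s`. -/
def IsMeromorphicContinuation {ι : Type} (u : ℂ → ι → ℂ) (F : ℂ → ℂ) : Prop :=
  MeromorphicOn F Set.univ ∧ ∀ s : ℂ, 1 < s.re → HasSum (u s) (F s)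

/-- The value `B_n(x)` of the Bernoulli polynomial (so `B_1(0) = -1/2`), as a complex number. -/
noncomputable def bernoulliValue (n : ℕ) (x : ℚ) : ℂ :=
  (((Polynomial.bernoulli n).eval x : ℚ) : ℂ)

/-- The explicit combination of zeta values `ζ(s + p + q + r - ξ)` in the functional relation. The
exponents of `-1` are integers, since `p - ω` may be negative. -/
noncomputable def zetaPSp2Explicit (p q r : ℕ) (s : ℂ) : ℂ :=
  (∑ ξ ∈ Finset.range (p + 1), ∑ ω ∈ Finset.range (p - ξ + 1),
    ((ω + r - 1).choose ω : ℂ) * ((p + q - 1 - ξ - ω).choose (q - 1) : ℂ) *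
      ((-1 : ℂ) ^ ((p : ℤ) - (ξ : ℤ)) / 2 ^ (r + ω)) *
      ((2 * (Real.pi : ℂ) * Complex.I) ^ ξ / (ξ.factorial : ℂ)) *
      riemannZeta (s + p + q + r - ξ) *
      ((bernoulliValue ξ 0 - bernoulliValue ξ (1 / 2)) / 2)) +
  (∑ ξ ∈ Finset.range (q + 1), ∑ ω ∈ Finset.range (q - ξ + 1),
    ((ω + r - 1).choose ω : ℂ) * ((p + q - 1 - ξ - ω).choose (p - 1) : ℂ) *
      (-1 : ℂ) ^ ((p : ℤ) - (ω : ℤ)) *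
      ((2 * (Real.pi : ℂ) * Complex.I) ^ ξ / (ξ.factorial : ℂ)) *
      riemannZeta (s + p + q + r - ξ) *
      ((bernoulliValue ξ 0 -
        ((2 : ℂ) ^ (1 - s - p - q - r + ξ) - 1) * bernoulliValue ξ (1 / 2)) / 2)) +
  (∑ ξ ∈ Finset.range (r + 1), ∑ ω ∈ Finset.range p,
    ((ω + r - ξ).choose ω : ℂ) * ((p + q - 2 - ω).choose (q - 1) : ℂ) *
      ((-1 : ℂ) ^ p / 2 ^ (r - ξ + ω + 1)) *
      ((2 * (Real.pi : ℂ) * Complex.I) ^ ξ / (ξ.factorial : ℂ)) *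
      riemannZeta (s + p + q + r - ξ) *
      ((bernoulliValue ξ 0 - bernoulliValue ξ (1 / 2)) / 2)) +
  (∑ ξ ∈ Finset.range (r + 1), ∑ ω ∈ Finset.range q,
    ((ω + r - ξ).choose ω : ℂ) * ((p + q - 2 - ω).choose (p - 1) : ℂ) *
      (-1 : ℂ) ^ ((p : ℤ) - (ω : ℤ) + 1) *
      ((2 * (Real.pi : ℂ) * Complex.I) ^ ξ / (ξ.factorial : ℂ)) *
      riemannZeta (s + p + q + r - ξ) *
      ((bernoulliValue ξ 0 - bernoulliValue ξ (1 / 2)) / 2))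

/-! ### Partial fractions of 1 / (x^p (x + n)^q (x + 2n)^r) with explicit coefficients. -/

section PartialFractions

open Polynomial

/-! Consider the double sum of n^(-s) / (m^p (m + n)^q (m + 2n)^r) over n ≥ 1 and odd integers m ≠
-n. An odd m is never 0 or -2n, so m lies in one of the ranges m > 0, -n < m < 0, -2n < m < -n, m <
-2n. In each range a linear change of variables turns the sum into one of the four zeta-functions,
with the sign coming from the negative linear forms (`combinedTerm_combinedIndex`,
`combinedTerm_eq_sum_indicator`).

For fixed n the sum over m can be evaluated. Partial fractions in m (`partialFraction`) reduce it to
symmetric sums of inverse powers over a parity class, which are Bernoulli values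
(`tendsto_sum_oddTerm`). Two corrections occur. The Bernoulli formula is off by πi/2 for the
exponent 1, but the residues add up to 0 (`coeffA_add_coeffB_add_coeffC`). The excluded m = -n,
present only for odd n, contributes minus the constant Laurent coefficient at that pole
(`sum_coeff_at_neg`), which is exactly the ξ = 0 term of the second explicit sum. Summing over n
against n^(-s) yields zeta values, and `zetaPSp2Explicit_eq` matches the coefficients. This proves
the relation for Re s > 1.

For the continuation, each zeta-function is a Dirichlet series ∑ f(n) n^(-s) whose coefficient f is
an inner sum. By partial fractions f is built from powers of 1/n and functions with f(n + d) = f(n)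
+ g(n), g being elementary. Expanding (n + d)^(-u) binomially in such an equation expresses L(f, u +
1) through values of L(f, ·) further to the right and through L(g, ·), so the domain grows by one
unit at a time (`ContinuesTo.of_difference`). The identity theorem then carries the relation to all
regular points. -/

/-- The coefficient of `X ^ n` in the expansion of `(X + α) ^ (-k)` at `0`. -/
noncomputable def negPowCoeff (α : ℂ) (k n : ℕ) : ℂ :=
  (-1) ^ n * ((n + k - 1).choose n : ℂ) / α ^ (k + n)

/-- The power series of `(X + α) ^ (-k)` at `0`. -/
noncomputable def negPowSeries (α : ℂ) (k : ℕ) : PowerSeries ℂ :=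
  PowerSeries.mk (negPowCoeff α k)

/-- Coefficientwise this is Pascal's rule; it justifies reading `negPowSeries` as an inverse power.
-/
lemma X_add_C_mul_negPowSeries_succ {α : ℂ} (hα : α ≠ 0) (k : ℕ) :
    ((X + C α : ℂ[X]) : PowerSeries ℂ) * negPowSeries α (k + 1) = negPowSeries α k := by
  ext n
  rw [Polynomial.coe_add, Polynomial.coe_X, Polynomial.coe_C, add_mul, map_add,
    PowerSeries.coeff_C_mul]
  cases n with
  | zero =>
    simp only [PowerSeries.coeff_zero_X_mul, zero_add, negPowSeries, PowerSeries.coeff_mk,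
      negPowCoeff]
    field_simp
    simp [pow_succ']
  | succ n =>
    simp only [PowerSeries.coeff_succ_X_mul, negPowSeries, PowerSeries.coeff_mk, negPowCoeff]
    rw [show n + (k + 1) - 1 = n + k by omega, show n + 1 + (k + 1) - 1 = n + k + 1 by omega,
      show n + 1 + k - 1 = n + k by omega, Nat.choose_succ_succ]
    push_cast
    field_simp
    ring

lemma X_add_C_pow_mul_negPowSeries_add {α : ℂ} (hα : α ≠ 0) (k m : ℕ) :
    (((X + C α) ^ k : ℂ[X]) : PowerSeries ℂ) * negPowSeries α (m + k) = negPowSeries α m := by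
  induction k with
  | zero => simp
  | succ k ih =>
    rw [pow_succ, Polynomial.coe_mul, mul_assoc, ← add_assoc, X_add_C_mul_negPowSeries_succ hα, ih]

lemma negPowSeries_zero (α : ℂ) : negPowSeries α 0 = 1 := by
  ext n
  cases n with
  | zero => simp [negPowSeries, negPowCoeff]
  | succ n => simp [negPowSeries, negPowCoeff, PowerSeries.coeff_one]

lemma X_add_C_pow_mul_negPowSeries {α : ℂ} (hα : α ≠ 0) (k : ℕ) :
    (((X + C α) ^ k : ℂ[X]) : PowerSeries ℂ) * negPowSeries α k = 1 := by
  simpa [negPowSeries_zero] using X_add_C_pow_mul_negPowSeries_add hα k 0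

/-- The power series of `(X + α) ^ (-k) (X + β) ^ (-l)` at `0`. -/
noncomputable def negPowSeries₂ (α : ℂ) (k : ℕ) (β : ℂ) (l : ℕ) : PowerSeries ℂ :=
  negPowSeries α k * negPowSeries β l

lemma mul_negPowSeries₂ {α β : ℂ} (hα : α ≠ 0) (hβ : β ≠ 0) (k l : ℕ) :
    (((X + C α) ^ k * (X + C β) ^ l : ℂ[X]) : PowerSeries ℂ) * negPowSeries₂ α k β l = 1 := by
  rw [negPowSeries₂, Polynomial.coe_mul, mul_mul_mul_comm, X_add_C_pow_mul_negPowSeries hα,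
    X_add_C_pow_mul_negPowSeries hβ, one_mul]

/-- Truncating u at order p does not change the coefficients of f * u below p. -/
lemma X_pow_dvd_one_sub_mul_trunc {f : ℂ[X]} {u : PowerSeries ℂ}
    (h : (f : PowerSeries ℂ) * u = 1) (p : ℕ) : X ^ p ∣ 1 - f * PowerSeries.trunc p u := by
  rw [Polynomial.X_pow_dvd_iff]
  intro d hd
  have h2 : PowerSeries.coeff d ((f : PowerSeries ℂ) * (PowerSeries.trunc p u : PowerSeries ℂ)) =
      PowerSeries.coeff d ((f : PowerSeries ℂ) * u) := by
    rw [PowerSeries.coeff_mul_eq_coeff_trunc_mul_trunc₂ _ _ hd hd, PowerSeries.trunc_trunc,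
      ← PowerSeries.coeff_mul_eq_coeff_trunc_mul_trunc₂ _ _ hd hd]
  rw [← Polynomial.coeff_coe, Polynomial.coe_sub, Polynomial.coe_mul, map_sub, h2, h]
  simp

lemma X_add_C_pow_dvd_one_sub {f : ℂ[X]} {u : PowerSeries ℂ}
    (h : (f : PowerSeries ℂ) * u = 1) (p : ℕ) (α : ℂ) :
    (X + C α) ^ p ∣ 1 - f.comp (X + C α) * (PowerSeries.trunc p u).comp (X + C α) := by
  obtain ⟨g, hg⟩ := X_pow_dvd_one_sub_mul_trunc h p
  refine ⟨g.comp (X + C α), ?_⟩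
  simpa using congrArg (fun t : ℂ[X] => t.comp (X + C α)) hg

lemma degree_trunc_comp_lt (u : PowerSeries ℂ) (p : ℕ) (α : ℂ) :
    ((PowerSeries.trunc p u).comp (X + C α)).degree < p := by
  rw [← Polynomial.taylor_apply, Polynomial.degree_taylor]
  exact PowerSeries.degree_trunc_lt u p

lemma eq_one_of_dvd_one_sub {f g h t : ℂ[X]} (hfg : IsCoprime f g) (hfh : IsCoprime f h)
    (hgh : IsCoprime g h) (ht : (1 - t).degree < (f * g * h).degree)
    (hf : f ∣ 1 - t) (hg : g ∣ 1 - t) (hh : h ∣ 1 - t) : t = 1 := by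
  have h1 : f * g * h ∣ 1 - t :=
    (IsCoprime.mul_left hfh hgh).mul_dvd (hfg.mul_dvd hf hg) hh
  exact (sub_eq_zero.1 (Polynomial.eq_zero_of_dvd_of_degree_lt h1 ht)).symm

lemma isCoprime_X_add_C_pow {α β : ℂ} (h : α ≠ β) (k l : ℕ) :
    IsCoprime ((X + C α) ^ k) ((X + C β) ^ l) := by
  apply IsCoprime.pow
  have := Polynomial.isCoprime_X_sub_C_of_isUnit_sub (a := -α) (b := -β)
    (by rw [isUnit_iff_ne_zero]; intro h'; apply h; linear_combination -h')
  simpa using this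

/-- Chinese remainder argument: each summand is 1 modulo its own prime power and 0 modulo the other
two, so 1 minus the sum is divisible by the product, while its degree is below p + q + r. -/
lemma partialFraction_polynomial (p q r : ℕ) (hp : 1 ≤ p) {α β γ : ℂ}
    (hαβ : α ≠ β) (hαγ : α ≠ γ) (hβγ : β ≠ γ) :
    (PowerSeries.trunc p (negPowSeries₂ (β - α) q (γ - α) r)).comp (X + C α) *
        ((X + C β) ^ q * (X + C γ) ^ r) +
      (PowerSeries.trunc q (negPowSeries₂ (α - β) p (γ - β) r)).comp (X + C β) *
        ((X + C α) ^ p * (X + C γ) ^ r) +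
      (PowerSeries.trunc r (negPowSeries₂ (α - γ) p (β - γ) q)).comp (X + C γ) *
        ((X + C α) ^ p * (X + C β) ^ q) = 1 := by
  have key : ∀ (a b c : ℂ) (k l m : ℕ), b ≠ a → c ≠ a → (X + C a) ^ m ∣
      1 - ((X + C b) ^ k * (X + C c) ^ l) *
        (PowerSeries.trunc m (negPowSeries₂ (b - a) k (c - a) l)).comp (X + C a) := by
    intro a b c k l m hb hc
    have h := X_add_C_pow_dvd_one_sub
      (mul_negPowSeries₂ (sub_ne_zero.2 hb) (sub_ne_zero.2 hc) k l) m a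
    have e : ∀ b : ℂ, X + C a + C (b - a) = X + C b := by
      intro b; rw [C_sub]; ring
    simpa [-map_sub, e] using h
  have deg : ∀ (a b : ℂ) (k l m : ℕ) (u : ℂ[X]), u.degree < m →
      (u * ((X + C a) ^ k * (X + C b) ^ l)).degree < ((m + k + l : ℕ) : WithBot ℕ) := by
    intro a b k l m u hu
    have hM : ((X + C a) ^ k * (X + C b) ^ l).degree = ((k + l : ℕ) : WithBot ℕ) := by
      simp [degree_mul, degree_pow]
    rcases eq_or_ne u 0 with rfl | hu0
    · simp
    rw [degree_eq_natDegree hu0] at hu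
    rw [degree_mul, hM, degree_eq_natDegree hu0]
    have : u.natDegree < m := by exact_mod_cast hu
    norm_cast
    omega
  have three : ∀ d a b c : ℂ[X], d ∣ 1 - a → d ∣ b → d ∣ c → d ∣ 1 - (a + b + c) := by
    intro d a b c h1 h2 h3
    rw [show 1 - (a + b + c) = 1 - a - b - c by ring]
    exact dvd_sub (dvd_sub h1 h2) h3
  refine eq_one_of_dvd_one_sub (f := (X + C α) ^ p) (g := (X + C β) ^ q) (h := (X + C γ) ^ r)
    (isCoprime_X_add_C_pow hαβ _ _) (isCoprime_X_add_C_pow hαγ _ _)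
    (isCoprime_X_add_C_pow hβγ _ _) ?_ ?_ ?_ ?_
  · have : ((X + C α) ^ p * (X + C β) ^ q * (X + C γ) ^ r : ℂ[X]).degree =
        ((p + q + r : ℕ) : WithBot ℕ) := by
      simp [degree_mul, degree_pow]
    rw [this]
    refine (degree_sub_le _ _).trans_lt (max_lt ?_ ?_)
    · rw [degree_one]
      exact_mod_cast (by omega : 0 < p + q + r)
    refine (degree_add_le _ _).trans_lt (max_lt ((degree_add_le _ _).trans_lt (max_lt ?_ ?_)) ?_)
    · exact deg _ _ _ _ _ _ (degree_trunc_comp_lt _ _ _)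
    · convert deg α γ p r q _ (degree_trunc_comp_lt _ _ _) using 2
      omega
    · convert deg α β p q r _ (degree_trunc_comp_lt _ _ _) using 2
      omega
  · refine three _ _ _ _ ?_ ((dvd_mul_right _ _).mul_left _) ((dvd_mul_right _ _).mul_left _)
    rw [mul_comm]
    exact key α β γ q r p hαβ.symm hαγ.symm
  · rw [add_comm (_ * _) (_ * _)]
    refine three _ _ _ _ ?_ ((dvd_mul_right _ _).mul_left _) ((dvd_mul_left _ _).mul_left _)
    rw [mul_comm]
    exact key β α γ p r q hαβ hβγ.symm
  · rw [add_comm (_ + _) (_ * _), ← add_assoc]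
    refine three _ _ _ _ ?_ ((dvd_mul_left _ _).mul_left _) ((dvd_mul_left _ _).mul_left _)
    rw [mul_comm]
    exact key γ α β p q r hαγ hβγ

lemma eval_trunc (u : PowerSeries ℂ) (p : ℕ) (y : ℂ) :
    (PowerSeries.trunc p u).eval y = ∑ k ∈ Finset.range p, PowerSeries.coeff k u * y ^ k := by
  rw [Polynomial.eval, PowerSeries.eval₂_trunc_eq_sum_range]
  simp

/-- Coefficients of the principal part at `x = 0` of `1 / (x ^ p (x + 1) ^ q (x + 2) ^ r)`. -/
noncomputable def coeffA (q r k : ℕ) : ℂ := PowerSeries.coeff k (negPowSeries₂ 1 q 2 r)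

/-- Coefficients of the principal part at `x = -1` of `1 / (x ^ p (x + 1) ^ q (x + 2) ^ r)`. -/
noncomputable def coeffB (p r k : ℕ) : ℂ := PowerSeries.coeff k (negPowSeries₂ (-1) p 1 r)

/-- Coefficients of the principal part at `x = -2` of `1 / (x ^ p (x + 1) ^ q (x + 2) ^ r)`. -/
noncomputable def coeffC (p q k : ℕ) : ℂ := PowerSeries.coeff k (negPowSeries₂ (-2) p (-1) q)

lemma partialFraction_polynomial_zero_one_two (p q r : ℕ) (hp : 1 ≤ p) :
    PowerSeries.trunc p (negPowSeries₂ 1 q 2 r) * ((X + C 1) ^ q * (X + C 2) ^ r) +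
      (PowerSeries.trunc q (negPowSeries₂ (-1) p 1 r)).comp (X + C 1) *
        (X ^ p * (X + C 2) ^ r) +
      (PowerSeries.trunc r (negPowSeries₂ (-2) p (-1) q)).comp (X + C 2) *
        (X ^ p * (X + C 1) ^ q) = 1 := by
  have h := partialFraction_polynomial p q r hp (α := 0) (β := 1) (γ := 2)
    (by norm_num) (by norm_num) (by norm_num)
  rw [show (1 : ℂ) - 0 = 1 by norm_num, show (2 : ℂ) - 0 = 2 by norm_num,
    show (0 : ℂ) - 1 = -1 by norm_num, show (2 : ℂ) - 1 = 1 by norm_num,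
    show (0 : ℂ) - 2 = -2 by norm_num, show (1 : ℂ) - 2 = -1 by norm_num] at h
  simpa only [C_0, add_zero, comp_X] using h

lemma sum_coeff_eq_one (p q r : ℕ) (hp : 1 ≤ p) (y : ℂ) :
    (∑ k ∈ Finset.range p, coeffA q r k * y ^ k) * ((y + 1) ^ q * (y + 2) ^ r) +
      (∑ k ∈ Finset.range q, coeffB p r k * (y + 1) ^ k) * (y ^ p * (y + 2) ^ r) +
      (∑ k ∈ Finset.range r, coeffC p q k * (y + 2) ^ k) * (y ^ p * (y + 1) ^ q) = 1 := by
  have h := congrArg (Polynomial.eval y) (partialFraction_polynomial_zero_one_two p q r hp)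
  simpa only [eval_add, eval_mul, eval_comp, eval_trunc, eval_pow, eval_X, eval_C, eval_one,
    coeffA, coeffB, coeffC] using h

lemma coeff_trunc_comp (u : PowerSeries ℂ) (n : ℕ) (α : ℂ) :
    ((PowerSeries.trunc (n + 1) u).comp (X + C α)).coeff n = PowerSeries.coeff n u := by
  rw [PowerSeries.trunc_succ, add_comp, coeff_add,
    coeff_eq_zero_of_degree_lt (degree_trunc_comp_lt u n α), zero_add, monomial_comp, coeff_C_mul,
    coeff_X_add_C_pow]
  simp

/-- The residues of a rational function that decays at least like x^(-2) add up to 0. Algebraically,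
this is the top coefficient of the polynomial partial fraction identity, whose right side is the
constant 1. -/
lemma coeffA_add_coeffB_add_coeffC (p q r : ℕ) :
    coeffA (q + 1) (r + 1) p + coeffB (p + 1) (r + 1) q + coeffC (p + 1) (q + 1) r = 0 := by
  have key : ∀ (a b c : ℂ) (k l m : ℕ) (u : PowerSeries ℂ),
      ((PowerSeries.trunc (m + 1) u).comp (X + C a) *
        ((X + C b) ^ k * (X + C c) ^ l)).coeff (m + (k + l)) = PowerSeries.coeff m u := by
    intro a b c k l m u
    have hM : ((X + C b) ^ k * (X + C c) ^ l : ℂ[X]).Monic :=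
      ((monic_X_add_C b).pow k).mul ((monic_X_add_C c).pow l)
    have hd : ((X + C b) ^ k * (X + C c) ^ l : ℂ[X]).natDegree = k + l := by
      rw [((monic_X_add_C b).pow k).natDegree_mul ((monic_X_add_C c).pow l)]
      simp
    have h1 : ((PowerSeries.trunc (m + 1) u).comp (X + C a)).natDegree ≤ m := by
      have := degree_trunc_comp_lt u (m + 1) a
      exact natDegree_le_iff_degree_le.2 (Order.le_of_lt_succ (by exact_mod_cast this))
    rw [coeff_mul_add_eq_of_natDegree_le h1 hd.le, coeff_trunc_comp]
    have : ((X + C b) ^ k * (X + C c) ^ l : ℂ[X]).coeff (k + l) = 1 := by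
      rw [← hd]; exact hM
    rw [this, mul_one]
  have h := congrArg (fun t : ℂ[X] => t.coeff (p + q + r + 2))
    (partialFraction_polynomial_zero_one_two (p + 1) (q + 1) (r + 1) (by omega))
  have hA := key 0 1 2 (q + 1) (r + 1) p (negPowSeries₂ 1 (q + 1) 2 (r + 1))
  have hB := key 1 0 2 (p + 1) (r + 1) q (negPowSeries₂ (-1) (p + 1) 1 (r + 1))
  have hC := key 2 0 1 (p + 1) (q + 1) r (negPowSeries₂ (-2) (p + 1) (-1) (q + 1))
  rw [show p + (q + 1 + (r + 1)) = p + q + r + 2 by ring, C_0, add_zero, comp_X] at hA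
  rw [show q + (p + 1 + (r + 1)) = p + q + r + 2 by ring, C_0, add_zero] at hB
  rw [show r + (p + 1 + (q + 1)) = p + q + r + 2 by ring, C_0, add_zero] at hC
  simp only [coeff_add] at h
  rw [hA, hB, hC, coeff_one, if_neg (by omega)] at h
  exact h

lemma partialFraction (p q r : ℕ) (hp : 1 ≤ p) {n x : ℂ} (hn : n ≠ 0) (hx : x ≠ 0)
    (hx1 : x + n ≠ 0) (hx2 : x + 2 * n ≠ 0) :
    1 / (x ^ p * (x + n) ^ q * (x + 2 * n) ^ r) =
      ∑ k ∈ Finset.range p, coeffA q r k / (n ^ (q + r + k) * x ^ (p - k)) +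
      ∑ k ∈ Finset.range q, coeffB p r k / (n ^ (p + r + k) * (x + n) ^ (q - k)) +
      ∑ k ∈ Finset.range r, coeffC p q k / (n ^ (p + q + k) * (x + 2 * n) ^ (r - k)) := by
  -- Both sides are homogeneous of degree -(p + q + r) in (x, n), so only n = 1 has to be treated.
  obtain ⟨y, rfl⟩ : ∃ y, x = n * y := ⟨x / n, by field_simp⟩
  have hy : y ≠ 0 := right_ne_zero_of_mul hx
  have e1 : n * y + n = n * (y + 1) := by ring
  have e2 : n * y + 2 * n = n * (y + 2) := by ring
  rw [e1] at hx1 ⊢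
  rw [e2] at hx2 ⊢
  have hy1 : y + 1 ≠ 0 := right_ne_zero_of_mul hx1
  have hy2 : y + 2 ≠ 0 := right_ne_zero_of_mul hx2
  have key : ∀ (a : ℕ → ℂ) (z : ℂ) (m l : ℕ), z ≠ 0 →
      ∑ k ∈ Finset.range m, a k / (n ^ (l + k) * (n * z) ^ (m - k)) =
        (∑ k ∈ Finset.range m, a k * z ^ k) / (n ^ (l + m) * z ^ m) := by
    intro a z m l hz
    rw [Finset.sum_div]
    refine Finset.sum_congr rfl fun k hk => ?_
    obtain ⟨j, rfl⟩ := Nat.exists_eq_add_of_le (Finset.mem_range.1 hk).le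
    rw [show k + j - k = j by omega]
    field_simp
    ring
  rw [key _ _ _ _ hy, key _ _ _ _ hy1, key _ _ _ _ hy2]
  have h := sum_coeff_eq_one p q r hp y
  generalize (∑ k ∈ Finset.range p, coeffA q r k * y ^ k) = a at *
  generalize (∑ k ∈ Finset.range q, coeffB p r k * (y + 1) ^ k) = b at *
  generalize (∑ k ∈ Finset.range r, coeffC p q k * (y + 2) ^ k) = c at *
  have e : 1 / ((n * y) ^ p * (n * (y + 1)) ^ q * (n * (y + 2)) ^ r) =
      (a * ((y + 1) ^ q * (y + 2) ^ r) + b * (y ^ p * (y + 2) ^ r) +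
        c * (y ^ p * (y + 1) ^ q)) / ((n * y) ^ p * (n * (y + 1)) ^ q * (n * (y + 2)) ^ r) := by
    rw [h]
  rw [e]
  simp only [mul_pow]
  field_simp
  ring

/-- In the Laurent expansion at x = -n, the parts coming from the other two poles are regular, so
their value at x = -n is the constant coefficient of the whole function, which has index q in the
numbering of `coeffB`. -/
lemma sum_coeff_at_neg (p q r : ℕ) (hp : 1 ≤ p) {n : ℂ} (hn : n ≠ 0) :
    ∑ k ∈ Finset.range p, coeffA q r k / (n ^ (q + r + k) * (-n) ^ (p - k)) +
      ∑ k ∈ Finset.range r, coeffC p q k / (n ^ (p + q + k) * n ^ (r - k)) =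
      coeffB p r q / n ^ (p + q + r) := by
  set A := PowerSeries.trunc p (negPowSeries₂ 1 q 2 r) with hA
  set D := PowerSeries.trunc r (negPowSeries₂ (-2) p (-1) q) with hD
  set v := negPowSeries₂ (-1) p 1 r with hv
  have h := congrArg (fun t : ℂ[X] => ((t.comp (X + C (-1)) : ℂ[X]) : PowerSeries ℂ) * v)
    (partialFraction_polynomial_zero_one_two p q r hp)
  have hvm := mul_negPowSeries₂ (α := -1) (β := 1) (by norm_num) (by norm_num) p r
  have hP := X_add_C_pow_mul_negPowSeries (α := -1) (by norm_num) p
  have hR := X_add_C_pow_mul_negPowSeries (α := 1) (by norm_num) r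
  have c1 : (X + C (-1) + C 1 : ℂ[X]) = X := by rw [add_assoc, ← C_add]; simp
  have c2 : (X + C (-1) + C 2 : ℂ[X]) = X + C 1 := by rw [add_assoc, ← C_add]; norm_num
  simp only [add_comp, mul_comp, comp_assoc, pow_comp, X_comp, C_comp, c1, c2, one_comp, comp_X,
    coe_add, coe_mul, coe_one, one_mul, ← hA, ← hD, ← hv] at h
  -- The identity, recentred at -1, is multiplied by the inverse v of the two factors that do not
  -- vanish there; the coefficient of X^q can then be read off.
  have h2 : v = ((X : ℂ[X]) ^ q : ℂ[X]) * (((A.comp (X + C (-1)) : ℂ[X]) : PowerSeries ℂ) *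
      negPowSeries (-1) p + ((D.comp (X + C 1) : ℂ[X]) : PowerSeries ℂ) * negPowSeries 1 r) +
      (PowerSeries.trunc q v : ℂ[X]) := by
    generalize (PowerSeries.trunc q v : ℂ[X]) = T at h ⊢
    rw [hv, negPowSeries₂] at h ⊢
    linear_combination -h + ((A.comp (X + C (-1)) : ℂ[X]) : PowerSeries ℂ) * ((X : ℂ[X]) ^ q : ℂ[X]) *
      negPowSeries (-1) p * hR + (T : PowerSeries ℂ) * (((X + C 1) ^ r : ℂ[X]) : PowerSeries ℂ) *
      negPowSeries 1 r * hP + (T : PowerSeries ℂ) * hR +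
      ((D.comp (X + C 1) : ℂ[X]) : PowerSeries ℂ) * ((X : ℂ[X]) ^ q : ℂ[X]) *
      negPowSeries 1 r * hP
  have h3 : coeffB p r q = A.eval (-1) * (1 / (-1) ^ p) + D.eval 1 := by
    have h4 := congrArg (PowerSeries.coeff q) h2
    have h5 := PowerSeries.coeff_X_pow_mul (((A.comp (X + C (-1)) : ℂ[X]) : PowerSeries ℂ) *
      negPowSeries (-1) p + ((D.comp (X + C 1) : ℂ[X]) : PowerSeries ℂ) * negPowSeries 1 r) q 0
    rw [zero_add] at h5
    rw [map_add, coe_pow, coe_X, h5, coeff_coe, PowerSeries.coeff_trunc, if_neg (lt_irrefl q), add_zero] at h4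
    simp only [map_add, PowerSeries.coeff_zero_eq_constantCoeff, map_mul,
      constantCoeff_coe, negPowSeries] at h4
    rw [coeffB, ← hv, h4, coeff_zero_eq_eval_zero, coeff_zero_eq_eval_zero]
    simp [← PowerSeries.coeff_zero_eq_constantCoeff_apply, negPowCoeff]
  rw [h3, hA, hD, eval_trunc, eval_trunc, add_div, Finset.sum_mul, Finset.sum_div, Finset.sum_div]
  congr 1
  · refine Finset.sum_congr rfl fun k hk => ?_
    obtain ⟨j, rfl⟩ := Nat.exists_eq_add_of_le (Finset.mem_range.1 hk).le
    rw [← coeffA, show k + j - k = j by omega, neg_pow n j]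
    have : (-1 : ℂ) ^ k * (-1) ^ k = 1 := by rw [← mul_pow]; simp
    field_simp
    ring_nf
  · refine Finset.sum_congr rfl fun k hk => ?_
    obtain ⟨j, rfl⟩ := Nat.exists_eq_add_of_le (Finset.mem_range.1 hk).le
    rw [← coeffC, show k + j - k = j by omega]
    field_simp
    ring

lemma coeffA_eq (q r k : ℕ) : coeffA (q + 1) r k = ∑ ω ∈ Finset.range (k + 1),
    ((ω + r - 1).choose ω : ℂ) * ((q + k - ω).choose q : ℂ) * ((-1) ^ k / 2 ^ (r + ω)) := by
  rw [coeffA, negPowSeries₂, mul_comm, PowerSeries.coeff_mul,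
    Finset.Nat.sum_antidiagonal_eq_sum_range_succ_mk]
  refine Finset.sum_congr rfl fun ω hω => ?_
  obtain ⟨j, rfl⟩ := Nat.exists_eq_add_of_le (Nat.lt_succ_iff.1 (Finset.mem_range.1 hω))
  simp only [negPowSeries, PowerSeries.coeff_mk, negPowCoeff]
  rw [show ω + j - ω = j by omega, show j + (q + 1) - 1 = q + j by omega,
    show q + (ω + j) - ω = q + j by omega, Nat.choose_symm_add]
  field_simp
  ring

lemma coeffB_eq (p r k : ℕ) : coeffB (p + 1) r k = ∑ ω ∈ Finset.range (k + 1),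
    ((ω + r - 1).choose ω : ℂ) * ((p + k - ω).choose p : ℂ) * (-1) ^ (p + 1 + ω) := by
  rw [coeffB, negPowSeries₂, mul_comm, PowerSeries.coeff_mul,
    Finset.Nat.sum_antidiagonal_eq_sum_range_succ_mk]
  refine Finset.sum_congr rfl fun ω hω => ?_
  obtain ⟨j, rfl⟩ := Nat.exists_eq_add_of_le (Nat.lt_succ_iff.1 (Finset.mem_range.1 hω))
  simp only [negPowSeries, PowerSeries.coeff_mk, negPowCoeff]
  rw [show ω + j - ω = j by omega, show j + (p + 1) - 1 = p + j by omega,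
    show p + (ω + j) - ω = p + j by omega, Nat.choose_symm_add]
  have h1 : (-1 : ℂ) ^ p * (-1) ^ p = 1 := by rw [← mul_pow]; simp
  have h2 : (-1 : ℂ) ^ j * (-1) ^ j = 1 := by rw [← mul_pow]; simp
  rw [one_pow, div_one, div_eq_mul_inv, ← inv_pow, show (-1 : ℂ)⁻¹ = -1 by norm_num]
  have h3 : (-1 : ℂ) ^ j * (-1) ^ (p + 1 + j) = (-1) ^ (p + 1) := by
    rw [pow_add _ (p + 1) j]; linear_combination (-1 : ℂ) ^ (p + 1) * h2
  rw [pow_add _ (p + 1) ω, ← h3]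
  ring

lemma trunc_comp_mul_negPowSeries (u : PowerSeries ℂ) {α : ℂ} (hα : α ≠ 0) (p : ℕ) :
    (((PowerSeries.trunc p u).comp (X + C α) : ℂ[X]) : PowerSeries ℂ) * negPowSeries α p =
      ∑ j ∈ Finset.range p, PowerSeries.C (PowerSeries.coeff j u) * negPowSeries α (p - j) := by
  have h : (PowerSeries.trunc p u).comp (X + C α) =
      ∑ j ∈ Finset.range p, C (PowerSeries.coeff j u) * (X + C α) ^ j := by
    rw [Polynomial.comp, PowerSeries.eval₂_trunc_eq_sum_range]
  rw [h, ← Polynomial.coeToPowerSeries.ringHom_apply, map_sum, Finset.sum_mul]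
  refine Finset.sum_congr rfl fun j hj => ?_
  obtain ⟨m, rfl⟩ := Nat.exists_eq_add_of_le (Finset.mem_range.1 hj).le
  rw [Polynomial.coeToPowerSeries.ringHom_apply, coe_mul, coe_C, mul_assoc, add_comm j m,
    X_add_C_pow_mul_negPowSeries_add hα, Nat.add_sub_cancel]

/-- The product is expanded only after a partial fraction decomposition of its two factors, rather
than as a Cauchy product. This is what produces two separate sums over ω, as in the third and fourth
explicit sums. -/
lemma coeffC_eq_sum (p q k : ℕ) (hp : 1 ≤ p) : coeffC p q k =
    (∑ j ∈ Finset.range p, negPowCoeff 1 q j * negPowCoeff (-2) (p - j) k) +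
    ∑ j ∈ Finset.range q, negPowCoeff (-1) p j * negPowCoeff (-1) (q - j) k := by
  -- With r = 0 the three-factor identity degenerates to two factors; γ = 0 only has to differ from
  -- -2 and -1.
  have h := congrArg (fun t : ℂ[X] => (t : PowerSeries ℂ) * negPowSeries₂ (-2) p (-1) q)
    (partialFraction_polynomial p q 0 hp (α := -2) (β := -1) (γ := 0)
      (by norm_num) (by norm_num) (by norm_num))
  have hP := X_add_C_pow_mul_negPowSeries (α := -2) (by norm_num) p
  have hQ := X_add_C_pow_mul_negPowSeries (α := -1) (by norm_num) q
  simp only [negPowSeries₂, negPowSeries_zero, mul_one, pow_zero, coe_add, coe_mul, coe_one,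
    one_mul] at h
  have h0 : PowerSeries.trunc 0 (negPowSeries (-2 - 0) p * negPowSeries (-1 - 0) q) = 0 := by
    ext; simp
  rw [h0, zero_comp, coe_zero, zero_mul, add_zero, show (-1 : ℂ) - -2 = 1 by norm_num,
    show (-2 : ℂ) - -1 = -1 by norm_num] at h
  have h2 : negPowSeries (-2) p * negPowSeries (-1) q =
      (((PowerSeries.trunc p (negPowSeries 1 q)).comp (X + C (-2)) : ℂ[X]) : PowerSeries ℂ) *
        negPowSeries (-2) p +
      (((PowerSeries.trunc q (negPowSeries (-1) p)).comp (X + C (-1)) : ℂ[X]) : PowerSeries ℂ) *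
        negPowSeries (-1) q := by
    rw [← h]
    linear_combination
      (((PowerSeries.trunc p (negPowSeries 1 q)).comp (X + C (-2)) : ℂ[X]) : PowerSeries ℂ) *
        negPowSeries (-2) p * hQ +
      (((PowerSeries.trunc q (negPowSeries (-1) p)).comp (X + C (-1)) : ℂ[X]) : PowerSeries ℂ) *
        negPowSeries (-1) q * hP
  rw [coeffC, negPowSeries₂, h2, trunc_comp_mul_negPowSeries _ (by norm_num),
    trunc_comp_mul_negPowSeries _ (by norm_num), map_add, map_sum, map_sum]
  simp [PowerSeries.coeff_C_mul, negPowSeries]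

lemma coeffC_eq (p q k : ℕ) : coeffC (p + 1) (q + 1) k =
    (∑ ω ∈ Finset.range (p + 1), ((ω + k).choose ω : ℂ) * ((p + q - ω).choose q : ℂ) *
      ((-1) ^ (p + 1) / 2 ^ (k + ω + 1))) +
    ∑ ω ∈ Finset.range (q + 1), ((ω + k).choose ω : ℂ) * ((p + q - ω).choose p : ℂ) *
      (-1) ^ (p + 1 + ω + 1) := by
  have h1 : ∀ j : ℕ, (-1 : ℂ) ^ j * (-1) ^ j = 1 := fun j => by rw [← mul_pow]; simp
  rw [coeffC_eq_sum _ _ _ (by omega), ← Finset.sum_range_reflect,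
    ← Finset.sum_range_reflect (n := q + 1)]
  congr 1
  · refine Finset.sum_congr rfl fun ω hω => ?_
    obtain ⟨j, rfl⟩ := Nat.exists_eq_add_of_le (Nat.lt_succ_iff.1 (Finset.mem_range.1 hω))
    simp only [negPowCoeff]
    rw [show ω + j + 1 - 1 - ω = j by omega, show j + (q + 1) - 1 = q + j by omega,
      show ω + j + 1 - j = ω + 1 by omega, show k + (ω + 1) - 1 = ω + k by omega,
      show ω + j + q - ω = q + j by omega, Nat.choose_symm_add, Nat.choose_symm_add, neg_pow 2]
    have h2 := h1 k
    have h3 := h1 (ω + 1)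
    have h4 : (-1 : ℂ) ^ (ω + j + 1) = (-1) ^ j * (-1) ^ (ω + 1) := by rw [← pow_add]; ring
    rw [h4]
    have h5 : (-1 : ℂ) ^ (ω + 1 + k) = (-1) ^ (ω + 1) * (-1) ^ k := pow_add _ _ _
    rw [h5]
    have h6 : (-1 : ℂ) ^ (ω + 1) ≠ 0 := by simp
    have h7 : (-1 : ℂ) ^ k ≠ 0 := by simp
    rw [one_pow, div_one, show k + ω + 1 = ω + 1 + k by ring]
    generalize (-1 : ℂ) ^ (ω + 1) = s at *
    generalize (-1 : ℂ) ^ k = t at *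
    field_simp
    linear_combination (-((q + j).choose j : ℂ) * ((ω + k).choose k)) * h3
  · refine Finset.sum_congr rfl fun ω hω => ?_
    obtain ⟨j, rfl⟩ := Nat.exists_eq_add_of_le (Nat.lt_succ_iff.1 (Finset.mem_range.1 hω))
    simp only [negPowCoeff]
    rw [show ω + j + 1 - 1 - ω = j by omega, show j + (p + 1) - 1 = p + j by omega,
      show ω + j + 1 - j = ω + 1 by omega, show k + (ω + 1) - 1 = ω + k by omega,
      show p + (ω + j) - ω = p + j by omega, Nat.choose_symm_add, Nat.choose_symm_add]
    have h4 : (-1 : ℂ) ^ (p + 1 + ω + 1) = (-1) ^ (p + 1) * (-1) ^ (ω + 1) := by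
      rw [← pow_add]; ring
    rw [h4, pow_add _ (p + 1) j, pow_add _ (ω + 1) k]
    have e2 := h1 (p + 1)
    have e3 := h1 (ω + 1)
    have h6 : (-1 : ℂ) ^ (ω + 1) ≠ 0 := by simp
    have h7 : (-1 : ℂ) ^ k ≠ 0 := by simp
    have h8 : (-1 : ℂ) ^ j ≠ 0 := by simp
    have h9 : (-1 : ℂ) ^ (p + 1) ≠ 0 := by simp
    generalize (-1 : ℂ) ^ (ω + 1) = s at *
    generalize (-1 : ℂ) ^ (p + 1) = t at *
    generalize (-1 : ℂ) ^ k = u at *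
    generalize (-1 : ℂ) ^ j = v at *
    field_simp
    linear_combination (-((p + j).choose j : ℂ) * ((ω + k).choose k)) * (e2 * s ^ 2 + e3)

end PartialFractions

/-! ### Symmetric sums over odd integers and Bernoulli values. -/

section SymmetricSums

open Filter Topology

/-- The value, for `2 ≤ j`, of the sum of `m ^ (-j)` over all nonzero integers `m`, each `m` being
weighted by `(1 - σ (-1) ^ m) / 2`. -/
noncomputable def parityWeight (σ : ℂ) (j : ℕ) : ℂ :=
  -((2 * (Real.pi : ℂ) * Complex.I) ^ j / (j.factorial : ℂ) *
    ((bernoulliValue j 0 - σ * bernoulliValue j (1 / 2)) / 2))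

/-- The term `m ^ (-j)`, weighted by `(1 - σ (-1) ^ m) / 2`. -/
noncomputable def parityTerm (σ : ℂ) (j : ℕ) (m : ℤ) : ℂ :=
  (1 - σ * (-1) ^ m) / 2 / (m : ℂ) ^ j

lemma bernoulliValue_eq_bernoulliFun (j : ℕ) (x : ℚ) :
    bernoulliValue j x = ((bernoulliFun j (x : ℝ) : ℝ) : ℂ) := by
  rw [bernoulliValue, bernoulliFun, show ((x : ℝ)) = algebraMap ℚ ℝ x by simp,
    Polynomial.eval_map_algebraMap, Polynomial.aeval_algebraMap_apply]
  simp

lemma bernoulliValue_zero_left (x : ℚ) : bernoulliValue 0 x = 1 := by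
  simp [bernoulliValue]

lemma bernoulliValue_one_zero : bernoulliValue 1 0 = -1 / 2 := by
  rw [bernoulliValue_eq_bernoulliFun, bernoulliFun_one]
  norm_num

lemma bernoulliValue_one_half : bernoulliValue 1 (1 / 2) = 0 := by
  rw [bernoulliValue_eq_bernoulliFun, bernoulliFun_one]
  norm_num

lemma parityWeight_zero (σ : ℂ) : parityWeight σ 0 = -((1 - σ) / 2) := by
  simp [parityWeight, bernoulliValue_zero_left]

/-- Since B_1(1/2) = 0, this does not depend on σ. The defect at exponent 1 is therefore the same
for all three poles and can be cancelled by the vanishing of the residue sum. -/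
lemma parityWeight_one (σ : ℂ) : parityWeight σ 1 = Real.pi * Complex.I / 2 := by
  simp only [parityWeight, bernoulliValue_one_zero, bernoulliValue_one_half]
  simp
  ring

lemma hasSum_parityTerm (σ : ℂ) {j : ℕ} (hj : 2 ≤ j) :
    HasSum (parityTerm σ j) (parityWeight σ j) := by
  have h0 := hasSum_one_div_pow_mul_fourier_mul_bernoulliFun hj (x := 0) (by simp)
  have h1 := hasSum_one_div_pow_mul_fourier_mul_bernoulliFun hj (x := 1 / 2) (by norm_num)
  have h2 := (h0.sub (h1.mul_left σ)).div_const 2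
  convert! h2 using 1
  · funext m
    rw [fourier_coe_apply, fourier_coe_apply, parityTerm]
    have : Complex.exp (2 * Real.pi * Complex.I * m * ((1 / 2 : ℝ) : ℂ) / ((1 : ℝ) : ℂ)) =
        (-1) ^ m := by
      rw [← Complex.exp_pi_mul_I, ← Complex.exp_int_mul]
      congr 1
      push_cast
      ring
    rw [this]
    simp
    ring
  · rw [parityWeight, bernoulliValue_eq_bernoulliFun, bernoulliValue_eq_bernoulliFun]
    push_cast
    ring

lemma parityTerm_neg_one (σ : ℂ) (m : ℤ) : parityTerm σ 1 (-m) = -parityTerm σ 1 m := by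
  rw [parityTerm, parityTerm, zpow_neg, ← inv_zpow, show (-1 : ℂ)⁻¹ = -1 by norm_num]
  push_cast
  rw [pow_one, pow_one, div_neg]

lemma sum_Icc_int_sub (g : ℤ → ℂ) (M : ℕ) :
    ∑ m ∈ Finset.Icc (-(M : ℤ)) M, (g (m + 1) - g m) = g (M + 1) - g (-M) := by
  induction M with
  | zero => simp
  | succ M ih =>
    rw [Nat.cast_succ, Finset.sum_Icc_succ_eq_add_endpoints, ih]
    rw [show (-((M : ℤ) + 1) + 1) = -M by ring]
    ring

/-- Shifting by one changes the symmetric partial sum only by two boundary terms, which tend to 0.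
This matters for exponent 1, where convergence is merely conditional. -/
lemma tendsto_sum_Icc_shift {e : ℤ → ℂ} {L : ℂ} (he : Tendsto e cofinite (𝓝 0))
    (h : Tendsto (fun M : ℕ => ∑ m ∈ Finset.Icc (-(M : ℤ)) M, e m) atTop (𝓝 L)) (c : ℕ) :
    Tendsto (fun M : ℕ => ∑ m ∈ Finset.Icc (-(M : ℤ)) M, e (m + c)) atTop (𝓝 L) := by
  induction c with
  | zero => simpa using h
  | succ c ih =>
    have hsum : ∀ M : ℕ, ∑ m ∈ Finset.Icc (-(M : ℤ)) M, e (m + (c + 1 : ℕ)) =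
        ∑ m ∈ Finset.Icc (-(M : ℤ)) M, e (m + c) + (e (M + 1 + c) - e (-M + c)) := by
      intro M
      rw [← sum_Icc_int_sub (fun m => e (m + c)) M, ← Finset.sum_add_distrib]
      refine Finset.sum_congr rfl fun m _ => ?_
      push_cast
      ring_nf
    have h1 : Tendsto (fun M : ℕ => e ((M : ℤ) + 1 + c)) atTop (𝓝 0) := by
      refine he.comp ?_
      rw [← Nat.cofinite_eq_atTop]
      exact Function.Injective.tendsto_cofinite fun a b hab => by
        have : (a : ℤ) + 1 + c = b + 1 + c := hab
        omega
    have h2 : Tendsto (fun M : ℕ => e (-(M : ℤ) + c)) atTop (𝓝 0) := by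
      refine he.comp ?_
      rw [← Nat.cofinite_eq_atTop]
      exact Function.Injective.tendsto_cofinite fun a b hab => by
        have : -(a : ℤ) + c = -b + c := hab
        omega
    simp only [hsum]
    simpa using ih.add (h1.sub h2)

/-- For j = 1 the symmetric sum vanishes by oddness, whereas the Bernoulli expression is πi/2
because B_1(0) = -1/2; the `if` records the difference. -/
lemma tendsto_sum_Icc_parityTerm (σ : ℂ) {j : ℕ} (hj : 1 ≤ j) :
    Tendsto (fun M : ℕ => ∑ m ∈ Finset.Icc (-(M : ℤ)) M, parityTerm σ j m) atTop
      (𝓝 (parityWeight σ j - if j = 1 then Real.pi * Complex.I / 2 else 0)) := by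
  rcases eq_or_ne j 1 with rfl | hj1
  · have h : ∀ M : ℕ, ∑ m ∈ Finset.Icc (-(M : ℤ)) M, parityTerm σ 1 m = 0 := by
      intro M
      induction M with
      | zero => simp [parityTerm]
      | succ M ih =>
        rw [Nat.cast_succ, Finset.sum_Icc_succ_eq_add_endpoints, ih, parityTerm_neg_one]
        ring
    simp [h, parityWeight_one]
  · rw [if_neg hj1, sub_zero]
    have h2 : 2 ≤ j := by omega
    exact (hasSum_parityTerm σ h2).comp Finset.tendsto_Icc_neg

lemma tendsto_parityTerm_cofinite (n : ℤ) {j : ℕ} (hj : 1 ≤ j) :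
    Tendsto (parityTerm ((-1) ^ n) j) cofinite (𝓝 0) := by
  have h1 : Tendsto (fun m : ℤ => ‖(m : ℂ)‖⁻¹ ^ j) cofinite (𝓝 0) := by
    have h2 : Tendsto (fun m : ℤ => ‖(m : ℂ)‖⁻¹) cofinite (𝓝 0) := by
      have := tendsto_inv_atTop_zero.comp
        ((tendsto_norm_cocompact_atTop (E := ℝ)).comp Int.tendsto_coe_cofinite)
      refine this.congr fun m => ?_
      simp
    simpa [show j ≠ 0 by omega] using h2.pow j
  refine squeeze_zero_norm (fun m => ?_) h1
  rw [parityTerm, norm_div, norm_pow, inv_pow, div_eq_mul_inv]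
  refine mul_le_of_le_one_left (by positivity) ?_
  rw [norm_div]
  have : ‖(1 : ℂ) - (-1) ^ n * (-1) ^ m‖ ≤ 2 := by
    refine (norm_sub_le _ _).trans ?_
    simp [norm_zpow]
    norm_num
  simp
  linarith

/-- Only the last index of each sum has exponent 1, and the coefficients there are the three
residues. -/
lemma coeff_residue_sum (p q r : ℕ) (hp : 1 ≤ p) (hq : 1 ≤ q) (hr : 1 ≤ r) (n K : ℂ) :
    ∑ k ∈ Finset.range p, coeffA q r k / n ^ (q + r + k) * (if p - k = 1 then K else 0) +
      ∑ k ∈ Finset.range q, coeffB p r k / n ^ (p + r + k) * (if q - k = 1 then K else 0) +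
      ∑ k ∈ Finset.range r, coeffC p q k / n ^ (p + q + k) * (if r - k = 1 then K else 0) = 0 := by
  obtain ⟨p, rfl⟩ := Nat.exists_eq_add_of_le' hp
  obtain ⟨q, rfl⟩ := Nat.exists_eq_add_of_le' hq
  obtain ⟨r, rfl⟩ := Nat.exists_eq_add_of_le' hr
  have key : ∀ (f : ℕ → ℂ) (m : ℕ),
      ∑ k ∈ Finset.range (m + 1), f k * (if m + 1 - k = 1 then K else 0) = f m * K := by
    intro f m
    rw [Finset.sum_eq_single_of_mem m (by simp)]
    · simp
    · intro b hb hbm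
      have : b < m + 1 := Finset.mem_range.1 hb
      rw [if_neg (by omega), mul_zero]
  rw [key, key, key]
  have h := coeffA_add_coeffB_add_coeffC p q r
  rw [show q + 1 + (r + 1) + p = p + q + r + 2 by ring,
    show p + 1 + (r + 1) + q = p + q + r + 2 by ring,
    show p + 1 + (q + 1) + r = p + q + r + 2 by ring, ← add_mul, ← add_mul, ← add_div, ← add_div, h]
  simp

/-- The summand `1 / (m ^ p (m + n) ^ q (m + 2 n) ^ r)`, restricted to the odd integers `m`. It
vanishes at the pole `m = -n`. -/
noncomputable def oddTerm (p q r n : ℕ) (m : ℤ) : ℂ :=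
  if Odd m then 1 / ((m : ℂ) ^ p * ((m : ℂ) + n) ^ q * ((m : ℂ) + 2 * n) ^ r) else 0

/-- The factor (-1)^n in the middle sum compensates the shift m + n, so that every weight is the
indicator of odd m. At m = -n the left side and the middle terms are 0 by division by zero, but the
outer terms are not; their value, given by `sum_coeff_at_neg`, is subtracted. -/
lemma oddTerm_eq (p q r : ℕ) (hp : 1 ≤ p) (hq : 1 ≤ q) {n : ℕ} (hn : n ≠ 0) (m : ℤ) :
    oddTerm p q r n m =
      ∑ k ∈ Finset.range p, coeffA q r k / (n : ℂ) ^ (q + r + k) * parityTerm 1 (p - k) m +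
      ∑ k ∈ Finset.range q, coeffB p r k / (n : ℂ) ^ (p + r + k) *
        parityTerm ((-1) ^ (n : ℤ)) (q - k) (m + n) +
      ∑ k ∈ Finset.range r, coeffC p q k / (n : ℂ) ^ (p + q + k) *
        parityTerm 1 (r - k) (m + (2 * n : ℕ)) -
      (if m = -n then (1 - (-1) ^ n) / 2 * (coeffB p r q / (n : ℂ) ^ (p + q + r)) else 0) := by
  have hn' : (n : ℂ) ≠ 0 := by exact_mod_cast hn
  have hs : (-1 : ℂ) ^ (n : ℤ) * (-1) ^ (m + n) = (-1) ^ m := by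
    rw [zpow_add₀ (by norm_num), mul_left_comm, ← mul_zpow]
    simp
  have hs2 : (-1 : ℂ) ^ (m + (2 * n : ℕ)) = (-1) ^ m := by
    rw [zpow_add₀ (by norm_num), Even.neg_one_zpow (n := ((2 * n : ℕ) : ℤ)) (by simp), mul_one]
  simp only [parityTerm, hs, hs2]
  by_cases hm : Odd m
  · have hm1 : (-1 : ℂ) ^ m = -1 := hm.neg_one_zpow
    have hm0 : m ≠ 0 := by rintro rfl; simp at hm
    have hx : (m : ℂ) ≠ 0 := by exact_mod_cast hm0
    have hx2 : (m : ℂ) + 2 * n ≠ 0 := by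
      have : m + 2 * n ≠ 0 := by
        obtain ⟨l, rfl⟩ := hm
        omega
      exact_mod_cast this
    rw [oddTerm, if_pos hm, hm1]
    rw [show (1 - 1 * (-1 : ℂ)) / 2 = 1 by norm_num, show (1 - (-1 : ℂ)) / 2 = 1 by norm_num]
    push_cast
    simp only [div_mul_div_comm, mul_one]
    by_cases h : m = -n
    · subst h
      have hno : Odd n := by simpa [parity_simps] using hm
      have h1 := sum_coeff_at_neg p q r hp hn'
      have e : -(n : ℂ) + 2 * n = n := by ring
      have hB : ∑ k ∈ Finset.range q, coeffB p r k / ((n : ℂ) ^ (p + r + k) *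
          (((-(n : ℤ) : ℤ) : ℂ) + n) ^ (q - k)) = 0 := by
        refine Finset.sum_eq_zero fun k hk => ?_
        have : k < q := Finset.mem_range.1 hk
        simp [show q - k ≠ 0 by omega]
      push_cast at hB ⊢
      rw [hB, if_pos rfl, e, hno.neg_one_pow]
      rw [add_zero, h1]
      simp only [neg_add_cancel, zero_pow (show q ≠ 0 by omega)]
      norm_num
      rw [mul_div_mul_left _ _ (two_ne_zero), sub_self]
    · have hx1 : (m : ℂ) + n ≠ 0 := by
        intro h'
        apply h
        have : m + n = 0 := by exact_mod_cast h'
        omega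
      rw [if_neg h, sub_zero, partialFraction p q r hp hn' hx hx1 hx2]
  · have hm1 : (-1 : ℂ) ^ m = 1 := (Int.not_odd_iff_even.1 hm).neg_one_zpow
    rw [oddTerm, if_neg hm, hm1]
    have : (if m = -(n : ℤ) then (1 - (-1) ^ n) / 2 * (coeffB p r q / (n : ℂ) ^ (p + q + r))
        else 0) = 0 := by
      split_ifs with h
      · subst h
        have hne : Even n := by simpa [parity_simps] using hm
        simp [hne.neg_one_pow]
      · rfl
    rw [this]
    simp

/-- The ranges include k = p, q, r, where the exponent is 0. There `parityWeight 1 0` vanishes,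
while `parityWeight ((-1) ^ n) 0` supplies exactly the correction for the omitted m = -n. -/
lemma tendsto_sum_oddTerm (p q r : ℕ) (hp : 1 ≤ p) (hq : 1 ≤ q) (hr : 1 ≤ r) {n : ℕ}
    (hn : n ≠ 0) :
    Tendsto (fun M : ℕ => ∑ m ∈ Finset.Icc (-(M : ℤ)) M, oddTerm p q r n m) atTop
      (𝓝 (∑ k ∈ Finset.range (p + 1), coeffA q r k / (n : ℂ) ^ (q + r + k) *
          parityWeight 1 (p - k) +
        ∑ k ∈ Finset.range (q + 1), coeffB p r k / (n : ℂ) ^ (p + r + k) *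
          parityWeight ((-1) ^ n) (q - k) +
        ∑ k ∈ Finset.range (r + 1), coeffC p q k / (n : ℂ) ^ (p + q + k) *
          parityWeight 1 (r - k))) := by
  have key : ∀ (a : ℕ → ℂ) (c d : ℕ) (l : ℕ),
      Tendsto (fun M : ℕ => ∑ m ∈ Finset.Icc (-(M : ℤ)) M, ∑ k ∈ Finset.range l,
        a k * parityTerm ((-1) ^ (c : ℤ)) (l - k) (m + d)) atTop
      (𝓝 (∑ k ∈ Finset.range l, (a k * parityWeight ((-1) ^ c) (l - k) -
        a k * if l - k = 1 then Real.pi * Complex.I / 2 else 0))) := by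
    intro a c d l
    simp only [Finset.sum_comm (t := Finset.range l), ← mul_sub, ← Finset.mul_sum]
    refine tendsto_finsetSum _ fun k hk => ?_
    have : k < l := Finset.mem_range.1 hk
    refine Tendsto.const_mul _ ?_
    have h := tendsto_sum_Icc_shift (tendsto_parityTerm_cofinite c (j := l - k) (by omega))
      (tendsto_sum_Icc_parityTerm _ (by omega)) d
    simpa using h
  have hA := key (fun k => coeffA q r k / (n : ℂ) ^ (q + r + k)) 0 0 p
  have hB := key (fun k => coeffB p r k / (n : ℂ) ^ (p + r + k)) n n q
  have hC := key (fun k => coeffC p q k / (n : ℂ) ^ (p + q + k)) 0 (2 * n) r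
  have hE : Tendsto (fun M : ℕ => ∑ m ∈ Finset.Icc (-(M : ℤ)) M,
      if m = -n then (1 - (-1) ^ n) / 2 * (coeffB p r q / (n : ℂ) ^ (p + q + r)) else 0) atTop
      (𝓝 ((1 - (-1) ^ n) / 2 * (coeffB p r q / (n : ℂ) ^ (p + q + r)))) := by
    refine tendsto_const_nhds.congr' ?_
    filter_upwards [eventually_ge_atTop n] with M hM
    rw [Finset.sum_ite_eq', if_pos]
    rw [Finset.mem_Icc]
    omega
  have h := ((hA.add hB).add hC).sub hE
  simp only [← Finset.sum_add_distrib, ← Finset.sum_sub_distrib] at h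
  have hres := coeff_residue_sum p q r hp hq hr n (Real.pi * Complex.I / 2)
  convert h using 2
  · refine Finset.sum_congr rfl fun m _ => ?_
    rw [oddTerm_eq p q r hp hq hn]
    simp
  · simp only [Finset.sum_sub_distrib]
    rw [Finset.sum_range_succ _ p, Finset.sum_range_succ _ q, Finset.sum_range_succ _ r]
    simp only [Nat.sub_self, parityWeight_zero, pow_zero]
    rw [show p + r + q = p + q + r by ring]
    linear_combination hres

end SymmetricSums

/-! ### Binomial expansion of (n + d)^(-s) with a uniform remainder bound. -/

section TaylorRemainder

open Filter Topology

/-- The binomial coefficient of `x ^ k` in the expansion of `(1 + x) ^ (-s)`. -/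
noncomputable def negBinom (k : ℕ) (s : ℂ) : ℂ :=
  (∏ i ∈ Finset.range k, (-(s + i))) / (k.factorial : ℂ)

lemma negBinom_zero (s : ℂ) : negBinom 0 s = 1 := by simp [negBinom]

lemma negBinom_one (s : ℂ) : negBinom 1 s = -s := by simp [negBinom]

lemma negBinom_succ (k : ℕ) (s : ℂ) :
    negBinom (k + 1) s * (k + 1) = -s * negBinom k (s + 1) := by
  have : ((k.factorial : ℕ) : ℂ) ≠ 0 := by exact_mod_cast k.factorial_ne_zero
  have h2 : ((k : ℂ) + 1) ≠ 0 := by exact_mod_cast k.succ_ne_zero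
  rw [negBinom, negBinom, Finset.prod_range_succ', Nat.factorial_succ]
  push_cast
  field_simp
  rw [add_zero, mul_comm s]
  congr 2
  refine Finset.prod_congr rfl fun i _ => ?_
  ring

lemma differentiable_negBinom (k : ℕ) : Differentiable ℂ (negBinom k) := by
  unfold negBinom
  fun_prop

/-- The remainder of the binomial expansion of `(n + x) ^ (-s)` in powers of `x`. -/
noncomputable def binomRemainder (K : ℕ) (n x : ℂ) (s : ℂ) : ℂ :=
  (n + x) ^ (-s) - ∑ k ∈ Finset.range K, negBinom k s * x ^ k * n ^ (-s - k)

lemma hasDerivAt_binomRemainder (K : ℕ) {n : ℝ} (hn : 0 < n) {x : ℝ} (hx : 0 ≤ x) (s : ℂ) :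
    HasDerivAt (fun y : ℝ => binomRemainder (K + 1) n y s)
      (-s * binomRemainder K n x (s + 1)) x := by
  have h1 : HasDerivAt (fun z : ℂ => ((n : ℂ) + z) ^ (-s)) (-s * (n + x) ^ (-s - 1) * 1) (x : ℂ) := by
    refine HasDerivAt.cpow_const ((hasDerivAt_id (x : ℂ)).const_add (n : ℂ)) ?_
    left
    simp
    positivity
  have h2 : HasDerivAt (fun z : ℂ => ∑ k ∈ Finset.range (K + 1),
      negBinom k s * z ^ k * (n : ℂ) ^ (-s - k))
      (∑ k ∈ Finset.range (K + 1), negBinom k s * (k * (x : ℂ) ^ (k - 1)) * (n : ℂ) ^ (-s - k))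
      (x : ℂ) := by
    refine HasDerivAt.fun_sum fun k _ => ?_
    exact ((hasDerivAt_pow k (x : ℂ)).const_mul _).mul_const _
  convert! (h1.sub h2).comp_ofReal using 1
  rw [binomRemainder, Finset.sum_range_succ', mul_sub, Finset.mul_sum]
  simp only [Nat.cast_zero, zero_mul, mul_zero, add_zero, mul_one]
  congr 1
  · rw [neg_add']
  · refine Finset.sum_congr rfl fun k _ => ?_
    rw [Nat.add_sub_cancel]
    have := negBinom_succ k s
    push_cast
    rw [show -(s + 1) - (k : ℂ) = -s - (k + 1) by ring]
    linear_combination -((x : ℂ) ^ k * (n : ℂ) ^ (-s - (k + 1))) * this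

/-- The x-derivative of the remainder of order K + 1 at s is -s times the remainder of order K at s
+ 1, so the mean value inequality on [0, x] gives an induction. The condition on s keeps (n +
x)^(-Re s) ≤ n^(-Re s) in the base case. -/
lemma norm_binomRemainder_le (K : ℕ) {n : ℝ} (hn : 0 < n) {x : ℝ} (hx : 0 ≤ x) (s : ℂ)
    (hs : 0 ≤ s.re + K) :
    ‖binomRemainder K n x s‖ ≤
      (∏ i ∈ Finset.range K, ‖s + i‖) * x ^ K * n ^ (-s.re - K) := by
  induction K generalizing x s with
  | zero =>
    simp only [CharP.cast_eq_zero, add_zero] at hs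
    have hnx : 0 < n + x := by positivity
    have : ‖((n : ℂ) + x) ^ (-s)‖ = (n + x) ^ (-s.re) := by
      rw [← Complex.ofReal_add, Complex.norm_cpow_eq_rpow_re_of_pos hnx]
      simp
    simp only [binomRemainder, Finset.range_zero, Finset.sum_empty, sub_zero, this,
      Finset.prod_empty, pow_zero, one_mul, Nat.cast_zero]
    exact Real.rpow_le_rpow_of_nonpos hn (by linarith) (by linarith)
  | succ K ih =>
    have h0 : binomRemainder (K + 1) n ((0 : ℝ) : ℂ) s = 0 := by
      rw [binomRemainder, Finset.sum_range_succ']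
      simp [negBinom_zero]
    have hre : 0 ≤ (s + 1).re + K := by
      push_cast at hs
      simp
      linarith
    have h := norm_image_sub_le_of_norm_deriv_le_segment' (a := 0) (b := x)
      (f := fun y : ℝ => binomRemainder (K + 1) n y s)
      (C := (∏ i ∈ Finset.range (K + 1), ‖s + i‖) * x ^ K * n ^ (-s.re - (K + 1 : ℕ)))
      (fun y hy => (hasDerivAt_binomRemainder K hn hy.1 s).hasDerivWithinAt) ?_ x ⟨hx, le_rfl⟩
    · rw [h0, sub_zero, sub_zero] at h
      refine h.trans_eq ?_
      ring
    · intro y hy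
      rw [norm_mul, norm_neg]
      refine (mul_le_mul_of_nonneg_left (ih hy.1 (s + 1) hre) (norm_nonneg _)).trans ?_
      rw [Finset.prod_range_succ']
      have e1 : ∏ i ∈ Finset.range K, ‖s + 1 + i‖ = ∏ i ∈ Finset.range K, ‖s + (i + 1 : ℕ)‖ := by
        refine Finset.prod_congr rfl fun i _ => ?_
        push_cast
        ring_nf
      have e2 : -(s + 1).re - (K : ℝ) = -s.re - (K + 1 : ℕ) := by
        simp
        ring
      rw [e1, e2]
      have : y ^ K ≤ x ^ K := by
        have := hy.1
        have := hy.2.le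
        gcongr
      simp only [Nat.cast_zero, add_zero]
      calc _ = ((∏ i ∈ Finset.range K, ‖s + (i + 1 : ℕ)‖) * ‖s‖ * n ^ (-s.re - (K + 1 : ℕ))) *
            y ^ K := by ring
        _ ≤ ((∏ i ∈ Finset.range K, ‖s + (i + 1 : ℕ)‖) * ‖s‖ * n ^ (-s.re - (K + 1 : ℕ))) *
            x ^ K := by gcongr
        _ = _ := by ring

/-- `f n` grows at most linearly. -/
def LinearlyBounded (f : ℕ → ℂ) : Prop := ∃ C : ℝ, ∀ n : ℕ, n ≠ 0 → ‖f n‖ ≤ C * n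

lemma LinearlyBounded.exists_nonneg {f : ℕ → ℂ} (hf : LinearlyBounded f) :
    ∃ C : ℝ, 0 ≤ C ∧ ∀ n : ℕ, n ≠ 0 → ‖f n‖ ≤ C * n := by
  obtain ⟨C, hC⟩ := hf
  refine ⟨C, (norm_nonneg (f 1)).trans (by simpa using hC 1 one_ne_zero), hC⟩

lemma LinearlyBounded.lseriesSummable {f : ℕ → ℂ} (hf : LinearlyBounded f) {s : ℂ}
    (hs : 2 < s.re) : LSeriesSummable f s := by
  obtain ⟨C, hC⟩ := hf
  refine LSeriesSummable_of_le_const_mul_rpow hs ⟨C, fun n hn => ?_⟩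
  rw [show (2 : ℝ) - 1 = 1 by norm_num, Real.rpow_one]
  exact hC n hn

/-- With f(n) = O(n), the n-th remainder is O(n^(1 - Re s - K)) locally uniformly in s, hence
summable to an analytic function on Re s > 2 - K. -/
lemma exists_analytic_remainder {f : ℕ → ℂ} (hf : LinearlyBounded f) (d K : ℕ) (hK : 2 ≤ K) :
    ∃ R : ℂ → ℂ, (∀ s : ℂ, 2 - (K : ℝ) < s.re → AnalyticAt ℂ R s) ∧
      ∀ s : ℂ, 2 < s.re → HasSum (fun n : ℕ => if n = 0 then 0 else f n * ((n : ℂ) + d) ^ (-s))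
        (∑ k ∈ Finset.range K, negBinom k s * d ^ k * LSeries f (s + k) + R s) := by
  obtain ⟨C, hC0, hC⟩ := hf.exists_nonneg
  have hb : ∀ (n : ℕ) (s : ℂ) (r σ : ℝ), ‖s‖ ≤ r → -(K : ℝ) ≤ σ → σ ≤ s.re →
      ‖if n = 0 then 0 else f n * binomRemainder K n d s‖ ≤
        C * (∏ i ∈ Finset.range K, (r + i)) * d ^ K * (n : ℝ) ^ (1 - σ - K) := by
    intro n s r σ hr hσ hs
    have hr0 : 0 ≤ r := (norm_nonneg s).trans hr
    have hprod : 0 ≤ ∏ i ∈ Finset.range K, (r + i) := Finset.prod_nonneg fun i _ => by positivity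
    split_ifs with h
    · rw [norm_zero]
      positivity
    · have hn : (0 : ℝ) < n := by exact_mod_cast Nat.pos_of_ne_zero h
      have h1 := norm_binomRemainder_le K hn (x := d) (by positivity) s (by linarith)
      rw [norm_mul]
      have h2 : ∏ i ∈ Finset.range K, ‖s + i‖ ≤ ∏ i ∈ Finset.range K, (r + i) := by
        refine Finset.prod_le_prod (fun _ _ => norm_nonneg _) fun i _ => ?_
        refine (norm_add_le _ _).trans ?_
        simpa using hr
      have h3 : (n : ℝ) ^ (-s.re - K) ≤ (n : ℝ) ^ (-σ - K) := by
        refine Real.rpow_le_rpow_of_exponent_le ?_ (by linarith)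
        exact_mod_cast Nat.one_le_iff_ne_zero.2 h
      have h4 : (n : ℝ) ^ (1 - σ - K) = n * (n : ℝ) ^ (-σ - K) := by
        rw [show 1 - σ - K = 1 + (-σ - K) by ring, Real.rpow_add hn, Real.rpow_one]
      rw [h4]
      calc ‖f n‖ * ‖binomRemainder K n d s‖ ≤ (C * n) * ((∏ i ∈ Finset.range K, (r + i)) * d ^ K *
            (n : ℝ) ^ (-σ - K)) := by
            refine mul_le_mul (hC n h) ?_ (norm_nonneg _) (by positivity)
            refine h1.trans ?_
            gcongr
        _ = _ := by ring
  have hsum : ∀ (A σ : ℝ), 2 - (K : ℝ) < σ → Summable fun n : ℕ => A * (n : ℝ) ^ (1 - σ - K) := by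
    intro A σ hσ
    exact (Real.summable_nat_rpow.2 (by linarith)).mul_left _
  refine ⟨fun s => ∑' n : ℕ, if n = 0 then 0 else f n * binomRemainder K n d s, ?_, ?_⟩
  · intro s hs
    obtain ⟨σ, hσ, hσs⟩ := exists_between hs
    set U : Set ℂ := {z | σ < z.re} ∩ Metric.ball 0 (‖s‖ + 1) with hU
    have hUo : IsOpen U := (isOpen_lt continuous_const Complex.continuous_re).inter Metric.isOpen_ball
    have hsU : s ∈ U := ⟨hσs, by simp⟩
    refine DifferentiableOn.analyticAt (s := U) ?_ (hUo.mem_nhds hsU)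
    refine Complex.differentiableOn_tsum_of_summable_norm (hsum _ σ hσ) (fun n => ?_) hUo
      fun n w hw => hb n w (‖s‖ + 1) σ ?_ (by linarith) hw.1.le
    · by_cases hn : n = 0
      · simp [hn]
      · simp only [hn, if_false]
        have hn' : (n : ℂ) ≠ 0 := by exact_mod_cast hn
        have hnd : (n : ℂ) + d ≠ 0 := by exact_mod_cast (by omega : n + d ≠ 0)
        refine Differentiable.differentiableOn (Differentiable.const_mul ?_ _)
        unfold binomRemainder
        refine Differentiable.sub ?_ (Differentiable.fun_sum fun k _ => ?_)
        · exact differentiable_id.neg.const_cpow (Or.inl hnd)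
        · refine ((differentiable_negBinom k).mul_const _).mul ?_
          exact (differentiable_id.neg.sub_const _).const_cpow (Or.inl hn')
    · have := hw.2
      rw [mem_ball_zero_iff] at this
      exact this.le
  · intro s hs
    have h1 : HasSum (fun n : ℕ => if n = 0 then 0 else f n * binomRemainder K n d s)
        (∑' n : ℕ, if n = 0 then 0 else f n * binomRemainder K n d s) := by
      have hK' : (0 : ℝ) ≤ K := by positivity
      have hK2 : (2 : ℝ) ≤ K := by exact_mod_cast hK
      exact (Summable.of_norm_bounded (hsum _ s.re (by linarith))
        fun n => hb n s ‖s‖ s.re le_rfl (by linarith) le_rfl).hasSum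
    have h2 : ∀ k ∈ Finset.range K, HasSum (fun n : ℕ => negBinom k s * d ^ k *
        LSeries.term f (s + k) n) (negBinom k s * d ^ k * LSeries f (s + k)) := by
      intro k _
      have : 2 < (s + k).re := by
        simp
        have : (0 : ℝ) ≤ k := by positivity
        linarith
      exact (hf.lseriesSummable this).LSeriesHasSum.mul_left _
    convert (hasSum_sum h2).add h1 using 1
    funext n
    by_cases hn : n = 0
    · simp [hn]
    · simp only [hn, if_false]
      rw [binomRemainder, mul_sub, Finset.mul_sum]
      have : ∀ k ∈ Finset.range K, negBinom k s * d ^ k * LSeries.term f (s + k) n =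
          f n * (negBinom k s * d ^ k * (n : ℂ) ^ (-s - k)) := by
        intro k _
        rw [LSeries.term_of_ne_zero hn, div_eq_mul_inv, ← Complex.cpow_neg, neg_add']
        ring
      rw [Finset.sum_congr rfl this]
      ring

end TaylorRemainder

/-! ### Meromorphic continuation of Dirichlet series from difference equations. -/

section Continuation

open Filter Topology

/-- The Dirichlet series of `f` continues meromorphically to the half plane `σ < Re s`. -/
def ContinuesTo (σ : ℝ) (f : ℕ → ℂ) : Prop :=
  ∃ F : ℂ → ℂ, MeromorphicOn F {s | σ < s.re} ∧ ∃ x : ℝ, ∀ s : ℂ, x < s.re → F s = LSeries f s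

lemma ContinuesTo.mono {σ τ : ℝ} (h : σ ≤ τ) {f : ℕ → ℂ} (hf : ContinuesTo σ f) :
    ContinuesTo τ f := by
  obtain ⟨F, hF, x, hx⟩ := hf
  exact ⟨F, fun s hs => hF s (h.trans_lt hs), x, hx⟩

lemma ContinuesTo.congr {σ : ℝ} {f g : ℕ → ℂ} (hf : ContinuesTo σ f)
    (h : ∀ n, n ≠ 0 → f n = g n) : ContinuesTo σ g := by
  obtain ⟨F, hF, x, hx⟩ := hf
  exact ⟨F, hF, x, fun s hs => (hx s hs).trans (LSeries_congr (fun {n} hn => h n hn) s)⟩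

lemma meromorphicAt_comp_add {F : ℂ → ℂ} {s c : ℂ} (h : MeromorphicAt F (s + c)) :
    MeromorphicAt (fun z => F (z + c)) s :=
  h.comp_analyticAt (f := F) (g := fun z => z + c) (by fun_prop)

lemma continuesTo_of_norm_le {f : ℕ → ℂ} {x : ℝ} (h : ∃ C : ℝ, ∀ n : ℕ, n ≠ 0 → ‖f n‖ ≤ C * (n : ℝ) ^ x) :
    ContinuesTo (x + 1) f := by
  refine ⟨LSeries f, fun s hs => ?_, 0, fun s _ => rfl⟩
  have h1 := LSeries.abscissaOfAbsConv_le_of_le_const_mul_rpow h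
  refine (LSeries_analyticOnNhd f s (h1.trans_lt ?_)).meromorphicAt
  exact_mod_cast hs

lemma ContinuesTo.add {σ : ℝ} {f g : ℕ → ℂ} (hf : ContinuesTo σ f)
    (hf1 : LinearlyBounded f) (hg1 : LinearlyBounded g) (hg : ContinuesTo σ g) : ContinuesTo σ (fun n => f n + g n) := by
  obtain ⟨F, hF, x, hx⟩ := hf
  obtain ⟨G, hG, y, hy⟩ := hg
  refine ⟨F + G, hF.add hG, max 2 (max x y), fun s hs => ?_⟩
  rw [max_lt_iff, max_lt_iff] at hs
  rw [Pi.add_apply, hx s hs.2.1, hy s hs.2.2]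
  exact (LSeries_add (hf1.lseriesSummable hs.1) (hg1.lseriesSummable hs.1)).symm

/-- `f` grows at most linearly, and its Dirichlet series continues meromorphically to every half
plane. -/
def HasContinuation (f : ℕ → ℂ) : Prop := LinearlyBounded f ∧ ∀ σ : ℝ, ContinuesTo σ f

lemma HasContinuation.congr {f g : ℕ → ℂ} (hf : HasContinuation f)
    (h : ∀ n, n ≠ 0 → f n = g n) : HasContinuation g := by
  obtain ⟨⟨C, hC⟩, hf⟩ := hf
  exact ⟨⟨C, fun n hn => by rw [← h n hn]; exact hC n hn⟩, fun σ => (hf σ).congr h⟩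

lemma HasContinuation.add {f g : ℕ → ℂ} (hf : HasContinuation f) (hg : HasContinuation g) :
    HasContinuation (fun n => f n + g n) := by
  obtain ⟨hf1, hf⟩ := hf
  obtain ⟨hg1, hg⟩ := hg
  refine ⟨?_, fun σ => ?_⟩
  · obtain ⟨C, hC⟩ := hf1
    obtain ⟨D, hD⟩ := hg1
    refine ⟨C + D, fun n hn => (norm_add_le _ _).trans ?_⟩
    have := hC n hn
    have := hD n hn
    linarith
  · exact (hf σ).add hf1 hg1 (hg σ)

lemma HasContinuation.const_mul {f : ℕ → ℂ} (hf : HasContinuation f) (c : ℂ) :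
    HasContinuation (fun n => c * f n) := by
  obtain ⟨⟨C, hC⟩, hf⟩ := hf
  refine ⟨⟨‖c‖ * C, fun n hn => ?_⟩, fun σ => ?_⟩
  · rw [norm_mul, mul_assoc]
    gcongr
    exact hC n hn
  · obtain ⟨F, hF, x, hx⟩ := hf σ
    refine ⟨fun s => c * F s, fun s hs => (MeromorphicAt.const c s).mul (hF s hs), x, fun s hs => ?_⟩
    refine (congrArg (c * ·) (hx s hs)).trans ?_
    exact (LSeries_smul f c s).symm

lemma hasContinuation_zero : HasContinuation (fun _ => 0) := by
  refine ⟨⟨0, fun n _ => by simp⟩, fun σ => ⟨fun _ => 0, fun s _ => .const 0 s, 0, fun s _ => ?_⟩⟩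
  exact (congrFun LSeries_zero s).symm

lemma HasContinuation.sum {ι : Type*} {S : Finset ι} {f : ι → ℕ → ℂ}
    (hf : ∀ i ∈ S, HasContinuation (f i)) : HasContinuation (fun n => ∑ i ∈ S, f i n) := by
  classical
  induction S using Finset.induction_on with
  | empty => simpa using hasContinuation_zero
  | insert i S hi ih =>
    simp only [Finset.sum_insert hi]
    exact (hf i (Finset.mem_insert_self _ _)).add
      (ih fun j hj => hf j (Finset.mem_insert_of_mem hj))

lemma LSeries_div_pow (f : ℕ → ℂ) (k : ℕ) (s : ℂ) :
    LSeries (fun n => f n / (n : ℂ) ^ k) s = LSeries f (s + k) := by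
  refine tsum_congr fun n => ?_
  by_cases hn : n = 0
  · simp [hn]
  · have hn' : (n : ℂ) ≠ 0 := by exact_mod_cast hn
    rw [LSeries.term_of_ne_zero hn, LSeries.term_of_ne_zero hn, Complex.cpow_add _ _ hn',
      Complex.cpow_natCast, div_div, mul_comm]

lemma LinearlyBounded.div_pow {f : ℕ → ℂ} (hf : LinearlyBounded f) (k : ℕ) :
    LinearlyBounded (fun n => f n / (n : ℂ) ^ k) := by
  obtain ⟨C, hC⟩ := hf
  refine ⟨C, fun n hn => ?_⟩
  rw [norm_div, norm_pow, Complex.norm_natCast]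
  refine (div_le_self (norm_nonneg _) (one_le_pow₀ ?_)).trans (hC n hn)
  exact_mod_cast Nat.one_le_iff_ne_zero.2 hn

lemma HasContinuation.div_pow {f : ℕ → ℂ} (hf : HasContinuation f) (k : ℕ) :
    HasContinuation (fun n => f n / (n : ℂ) ^ k) := by
  refine ⟨hf.1.div_pow k, fun σ => ?_⟩
  obtain ⟨F, hF, x, hx⟩ := hf.2 (σ + k)
  refine ⟨fun s => F (s + k), fun s hs => meromorphicAt_comp_add (hF _ ?_), x, fun s hs => ?_⟩
  · have : σ < s.re := hs
    simpa using this
  · rw [LSeries_div_pow]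
    refine hx _ ?_
    have : (0 : ℝ) ≤ k := by positivity
    simp
    linarith

lemma one_div_add_eq_sum (n c : ℂ) (hn : n ≠ 0) (hc : n + c ≠ 0) (K : ℕ) :
    1 / (n + c) = ∑ i ∈ Finset.range K, (-c) ^ i / n ^ (i + 1) +
      (-c) ^ K / (n ^ K * (n + c)) := by
  induction K with
  | zero => simp
  | succ K ih =>
    rw [ih, Finset.sum_range_succ, add_assoc]
    congr 1
    field_simp
    ring

/-- The factor 1 / (n + c) is expanded geometrically in powers of 1/n. After K terms the remaining
coefficient is O(n^(1 - K)), so its series converges for Re s > 2 - K. -/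
lemma HasContinuation.div_add {f : ℕ → ℂ} (hf : HasContinuation f) {c : ℝ} (hc : 0 ≤ c) :
    HasContinuation (fun n => f n / ((n : ℂ) + c)) := by
  have hle : ∀ n : ℕ, n ≠ 0 → (1 : ℝ) ≤ ‖(n : ℂ) + c‖ := by
    intro n hn
    have h1 : (1 : ℝ) ≤ n := by exact_mod_cast Nat.one_le_iff_ne_zero.2 hn
    have h2 : (n : ℂ) + c = ((n + c : ℝ) : ℂ) := by push_cast; rfl
    rw [h2, Complex.norm_real, Real.norm_eq_abs]
    exact (by linarith : (1 : ℝ) ≤ n + c).trans (le_abs_self _)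
  obtain ⟨C, hC0, hC⟩ := hf.1.exists_nonneg
  have hb : LinearlyBounded (fun n => f n / ((n : ℂ) + c)) := by
    refine ⟨C, fun n hn => ?_⟩
    rw [norm_div]
    exact (div_le_self (norm_nonneg _) (hle n hn)).trans (hC n hn)
  refine ⟨hb, fun σ => ?_⟩
  obtain ⟨K, hK⟩ := exists_nat_gt (2 - σ)
  have h1 : HasContinuation (fun n => ∑ i ∈ Finset.range K, (-c : ℂ) ^ i * (f n / (n : ℂ) ^ (i + 1))) :=
    HasContinuation.sum fun i _ => (hf.div_pow (i + 1)).const_mul _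
  have hbd : ∀ n : ℕ, n ≠ 0 → ‖(-c : ℂ) ^ K * (f n / ((n : ℂ) + c) / (n : ℂ) ^ K)‖ ≤
      |c| ^ K * C * (n : ℝ) ^ (1 - K : ℝ) := by
    intro n hn
    have hn0 : (0 : ℝ) < n := by exact_mod_cast Nat.pos_of_ne_zero hn
    rw [norm_mul, norm_pow, norm_neg, Complex.norm_real, Real.norm_eq_abs, mul_assoc]
    refine mul_le_mul_of_nonneg_left ?_ (by positivity)
    rw [norm_div, norm_div, norm_pow, Complex.norm_natCast, Real.rpow_sub hn0, Real.rpow_one,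
      Real.rpow_natCast, ← mul_div_assoc]
    gcongr
    exact (div_le_self (norm_nonneg _) (hle n hn)).trans (hC n hn)
  have h2 : ContinuesTo σ (fun n => (-c : ℂ) ^ K * (f n / ((n : ℂ) + c) / (n : ℂ) ^ K)) :=
    (continuesTo_of_norm_le ⟨_, hbd⟩).mono (by linarith)
  have h3 : LinearlyBounded (fun n => (-c : ℂ) ^ K * (f n / ((n : ℂ) + c) / (n : ℂ) ^ K)) := by
    obtain ⟨D, hD⟩ := hb.div_pow K
    refine ⟨‖(-c : ℂ) ^ K‖ * D, fun n hn => ?_⟩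
    rw [norm_mul, mul_assoc]
    gcongr
    exact hD n hn
  refine ((h1.2 σ).add h1.1 h3 h2).congr fun n hn => ?_
  have hn' : (n : ℂ) ≠ 0 := by exact_mod_cast hn
  have hnc : (n : ℂ) + c ≠ 0 := by
    intro h
    have := hle n hn
    rw [h, norm_zero] at this
    linarith
  conv_rhs => rw [div_eq_mul_one_div, one_div_add_eq_sum _ _ hn' hnc K, mul_add, Finset.mul_sum]
  congr 1
  · exact Finset.sum_congr rfl fun i _ => by ring
  · field_simp

lemma HasContinuation.div_add_pow {f : ℕ → ℂ} (hf : HasContinuation f) {c : ℝ} (hc : 0 ≤ c)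
    (j : ℕ) : HasContinuation (fun n => f n / ((n : ℂ) + c) ^ j) := by
  induction j with
  | zero => simpa using hf
  | succ j ih => exact (ih.div_add hc).congr fun n _ => by rw [pow_succ, div_div]

/-- Multiplication by s - a leaves a removable singularity at a. -/
lemma meromorphicAt_of_tendsto_sub_mul {h : ℂ → ℂ} {a c : ℂ}
    (hd : ∀ s, s ≠ a → DifferentiableAt ℂ h s)
    (hc : Tendsto (fun s => (s - a) * h s) (𝓝[≠] a) (𝓝 c)) (s : ℂ) : MeromorphicAt h s := by
  have hana : ∀ s, s ≠ a → AnalyticAt ℂ h s := fun s hs =>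
    DifferentiableOn.analyticAt (s := {a}ᶜ)
      (fun z hz => (hd z hz).differentiableWithinAt) (isOpen_compl_singleton.mem_nhds hs)
  rcases eq_or_ne s a with rfl | hs
  · have h1 : AnalyticAt ℂ (Function.update (fun z => (z - s) * h z) s c) s := by
      refine Complex.analyticAt_of_differentiable_on_punctured_nhds_of_continuousAt ?_ ?_
      · filter_upwards [self_mem_nhdsWithin] with z hz
        refine DifferentiableAt.congr_of_eventuallyEq (f := fun z => (z - s) * h z) ?_ ?_
        · exact (differentiableAt_id.sub_const s).mul (hd z hz)
        · filter_upwards [isOpen_compl_singleton.mem_nhds hz] with w hw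
          exact Function.update_of_ne hw _ _
      · rwa [continuousAt_update_same]
    have h2 : MeromorphicAt (fun z => (z - s)⁻¹ *
        Function.update (fun z => (z - s) * h z) s c z) s := by
      refine MeromorphicAt.mul (MeromorphicAt.inv ?_) h1.meromorphicAt
      exact AnalyticAt.meromorphicAt (by fun_prop)
    refine h2.congr ?_
    filter_upwards [self_mem_nhdsWithin] with z hz
    rw [Function.update_of_ne hz, inv_mul_cancel_left₀ (sub_ne_zero.2 hz)]
  · exact (hana s hs).meromorphicAt

lemma meromorphicAt_riemannZeta (s : ℂ) : MeromorphicAt riemannZeta s :=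
  meromorphicAt_of_tendsto_sub_mul (fun _ hs => differentiableAt_riemannZeta hs)
    riemannZeta_residue_one s

lemma hasContinuation_periodic {N : ℕ} [NeZero N] (Φ : ZMod N → ℂ) :
    HasContinuation (fun n => Φ n) := by
  refine ⟨?_, fun σ => ⟨ZMod.LFunction Φ, fun s _ => ?_, 1, fun s hs => ?_⟩⟩
  · refine ⟨∑ x, ‖Φ x‖, fun n hn => ?_⟩
    have h1 : ‖Φ n‖ ≤ ∑ x, ‖Φ x‖ :=
      Finset.single_le_sum (f := fun x => ‖Φ x‖) (fun _ _ => norm_nonneg _) (Finset.mem_univ _)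
    refine h1.trans (le_mul_of_one_le_right ?_ ?_)
    · exact Finset.sum_nonneg fun _ _ => norm_nonneg _
    · exact_mod_cast Nat.one_le_iff_ne_zero.2 hn
  · exact meromorphicAt_of_tendsto_sub_mul (a := 1)
      (fun _ hs => ZMod.differentiableAt_LFunction Φ _ (Or.inl hs)) (ZMod.LFunction_residue_one Φ) s
  · exact ZMod.LFunction_eq_LSeries Φ hs

lemma hasContinuation_one : HasContinuation (fun _ => 1) :=
  (hasContinuation_periodic (N := 1) (fun _ => 1))

lemma hasSum_shift {f : ℕ → ℂ} {d : ℕ} {u : ℂ} (h : LSeriesSummable f u) :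
    HasSum (fun n : ℕ => if n = 0 then 0 else f (n + d) * ((n : ℂ) + d) ^ (-u))
      (LSeries f u - ∑ i ∈ Finset.range (d + 1), LSeries.term f u i) := by
  have h1 := (hasSum_nat_add_iff' (d + 1)).2 h.LSeriesHasSum
  rw [← hasSum_nat_add_iff' 1]
  convert! h1 using 1
  · funext n
    rw [if_neg n.succ_ne_zero, LSeries.term_of_ne_zero (by omega), Complex.cpow_neg,
      show n + (d + 1) = n + 1 + d by ring, div_eq_mul_inv]
    push_cast
    rfl
  · simp

/-- The series ∑ f(n + d) (n + d)^(-u) is L(f, u) minus finitely many terms. Replacing f(n + d) by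
f(n) + g(n) and expanding (n + d)^(-u), the k = 0 terms L(f, u) cancel and k = 1 gives -u d L(f, u +
1). Everything else involves f only at u + k with k ≥ 2, and is thus known for Re u > σ - 2. -/
lemma ContinuesTo.of_difference {f g : ℕ → ℂ} (hf : LinearlyBounded f) (hg : HasContinuation g)
    {d : ℕ} (hd : d ≠ 0) (h : ∀ n, n ≠ 0 → f (n + d) = f n + g n) {σ : ℝ}
    (hσ : ContinuesTo σ f) : ContinuesTo (σ - 1) f := by
  obtain ⟨F, hF, x, hx⟩ := hσ
  obtain ⟨G, hG, y, hy⟩ := hg.2 (σ - 2)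
  obtain ⟨K, hK⟩ := exists_nat_gt (2 - σ)
  obtain ⟨R, hR, hRs⟩ := exists_analytic_remainder hf d (K + 2) (by omega)
  obtain ⟨Q, hQ, hQs⟩ := exists_analytic_remainder hg.1 d (K + 2) (by omega)
  -- This is the resulting formula for L(f, u + 1). Division by u may create a pole, hence
  -- continuation is only meromorphic.
  set H : ℂ → ℂ := fun u => (∑ i ∈ Finset.range (d + 1), LSeries.term f u i +
    ∑ k ∈ Finset.range K, negBinom (k + 2) u * d ^ (k + 2) * F (u + (k + 2 : ℕ)) + R u +
    ∑ k ∈ Finset.range (K + 2), negBinom k u * d ^ k * G (u + k) + Q u) / (u * d) with hH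
  have hterm : ∀ i u, AnalyticAt ℂ (fun u => LSeries.term f u i) u := by
    intro i u
    exact (Differentiable.analyticAt (fun z => (LSeries.hasDerivAt_term f i z).differentiableAt) u)
  have hmer : ∀ u : ℂ, σ - 2 < u.re → MeromorphicAt H u := by
    intro u hu
    have hKu : 2 - ((K + 2 : ℕ) : ℝ) < u.re := by push_cast; linarith
    have hneg : ∀ k, MeromorphicAt (fun u => negBinom k u * (d : ℂ) ^ k) u := fun k =>
      (((differentiable_negBinom k).mul_const _).analyticAt u).meromorphicAt
    refine MeromorphicAt.div ?_ ((analyticAt_id.mul analyticAt_const).meromorphicAt)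
    refine (((MeromorphicAt.add ?_ ?_).add (hR u hKu).meromorphicAt).add ?_).add
      (hQ u hKu).meromorphicAt
    · exact MeromorphicAt.fun_sum fun i _ => (hterm i u).meromorphicAt
    · refine MeromorphicAt.fun_sum fun k _ => (hneg _).mul (meromorphicAt_comp_add (hF _ ?_))
      have : (0 : ℝ) ≤ k := by positivity
      simp
      linarith
    · refine MeromorphicAt.fun_sum fun k _ => (hneg _).mul (meromorphicAt_comp_add (hG _ ?_))
      have : (0 : ℝ) ≤ k := by positivity
      simp
      linarith
  have heq : ∀ u : ℂ, max 2 (max x y) < u.re → H u = LSeries f (u + 1) := by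
    intro u hu
    rw [max_lt_iff, max_lt_iff] at hu
    obtain ⟨hu2, hux, huy⟩ := hu
    have hu0 : u ≠ 0 := by
      rintro rfl
      simp at hu2
      linarith
    have hd' : (d : ℂ) ≠ 0 := by exact_mod_cast hd
    have h1 := hasSum_shift (d := d) (hf.lseriesSummable hu2)
    have h2 := (hRs u hu2).add (hQs u hu2)
    have h3 := h1.unique (h2.congr_fun fun n => ?_)
    · have hF' : ∀ k : ℕ, F (u + (k + 2 : ℕ)) = LSeries f (u + (k + 2 : ℕ)) := fun k => hx _ (by
        have : (0 : ℝ) ≤ k := by positivity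
        simp
        linarith)
      have hG' : ∀ k : ℕ, G (u + k) = LSeries g (u + k) := fun k => hy _ (by
        have : (0 : ℝ) ≤ k := by positivity
        simp
        linarith)
      rw [Finset.sum_range_succ' _ (K + 1), Finset.sum_range_succ' _ K] at h3
      simp only [hH, hF', hG']
      rw [div_eq_iff (mul_ne_zero hu0 hd')]
      simp only [zero_add, negBinom_zero, negBinom_one, Nat.cast_zero, Nat.cast_one, add_zero,
        pow_zero, pow_one, one_mul] at h3
      linear_combination -h3
    · by_cases hn : n = 0
      · simp [hn]
      · simp only [hn, if_false]
        rw [h n hn]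
        ring
  refine ⟨fun s => H (s - 1), fun s hs => ?_, max 2 (max x y) + 1, fun s hs => ?_⟩
  · simp only [sub_eq_add_neg]
    refine meromorphicAt_comp_add (hmer _ ?_)
    have : σ - 1 < s.re := hs
    simp
    linarith
  · refine (heq (s - 1) ?_).trans (by rw [sub_add_cancel])
    simp only [Complex.sub_re, Complex.one_re]
    linarith

lemma LinearlyBounded.of_difference {f g : ℕ → ℂ} {d : ℕ} (hd : d ≠ 0) (C : ℝ)
    (hg : ∀ n, n ≠ 0 → ‖g n‖ ≤ C) (h : ∀ n, n ≠ 0 → f (n + d) = f n + g n) :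
    LinearlyBounded f := by
  have hC : 0 ≤ C := (norm_nonneg _).trans (hg 1 one_ne_zero)
  set B := ∑ i ∈ Finset.range (d + 1), ‖f i‖ with hB
  have hB0 : 0 ≤ B := Finset.sum_nonneg fun _ _ => norm_nonneg _
  refine ⟨B + C, fun n hn => ?_⟩
  induction n using Nat.strong_induction_on with
  | _ n ih =>
    have hn1 : (1 : ℝ) ≤ n := by exact_mod_cast Nat.one_le_iff_ne_zero.2 hn
    rcases Nat.lt_or_ge n (d + 1) with hlt | hge
    · have h1 : ‖f n‖ ≤ B := Finset.single_le_sum (f := fun i => ‖f i‖)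
        (fun _ _ => norm_nonneg _) (Finset.mem_range.2 hlt)
      nlinarith
    · obtain ⟨m, rfl⟩ := Nat.exists_eq_add_of_le' (show d ≤ n by omega)
      have hm : m ≠ 0 := by omega
      rw [h m hm]
      refine (norm_add_le _ _).trans ?_
      have h1 := ih m (by omega) hm
      have h2 := hg m hm
      have h3 : (1 : ℝ) ≤ d := by exact_mod_cast Nat.one_le_iff_ne_zero.2 hd
      push_cast
      nlinarith

/-- A bounded difference gives linear growth, so the series converges for Re s > 2; from there each
use of the difference equation gains one unit. -/
lemma HasContinuation.of_difference {f g : ℕ → ℂ} (hg : HasContinuation g) {d : ℕ} (hd : d ≠ 0)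
    (C : ℝ) (hgC : ∀ n, n ≠ 0 → ‖g n‖ ≤ C) (h : ∀ n, n ≠ 0 → f (n + d) = f n + g n) :
    HasContinuation f := by
  have hf : LinearlyBounded f := .of_difference hd C hgC h
  refine ⟨hf, fun σ => ?_⟩
  have key : ∀ L : ℕ, ContinuesTo (2 - L) f := by
    intro L
    induction L with
    | zero =>
      obtain ⟨C, hC⟩ := hf
      refine (continuesTo_of_norm_le (x := 1) ⟨C, fun n hn => ?_⟩).mono (by norm_num)
      rw [Real.rpow_one]
      exact hC n hn
    | succ L ih =>
      refine (ih.of_difference hf hg hd h).mono ?_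
      push_cast
      linarith
  obtain ⟨L, hL⟩ := exists_nat_gt (2 - σ)
  exact (key L).mono (by linarith)

end Continuation

/-! ### The coefficients f(n) obtained by summing over the other variable. -/

section InnerSums

open Filter Topology

lemma hasContinuation_odd : HasContinuation (fun n => if Odd n then 1 else 0) :=
  (hasContinuation_periodic (N := 2) (fun x => if x = 1 then 1 else 0)).congr fun n _ => by
    simp only [ZMod.natCast_eq_one_iff_odd]

lemma hasContinuation_even : HasContinuation (fun n => if Even n then 1 else 0) :=
  (hasContinuation_periodic (N := 2) (fun x => if x = 0 then 1 else 0)).congr fun n _ => by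
    simp only [ZMod.natCast_eq_zero_iff_even]

lemma hasContinuation_one_div_add_one_pow (j : ℕ) :
    HasContinuation (fun n => 1 / ((n : ℂ) + 1) ^ j) := by
  simpa using hasContinuation_one.div_add_pow (c := 1) zero_le_one j

lemma hasContinuation_one_div_two_mul_add_one_pow (j : ℕ) :
    HasContinuation (fun n => 1 / (2 * (n : ℂ) + 1) ^ j) := by
  refine ((hasContinuation_one.div_add_pow (c := 1 / 2) (by norm_num) j).const_mul
    (1 / 2 ^ j)).congr fun n _ => ?_
  rw [div_mul_div_comm, ← mul_pow]
  congr 2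
  · norm_num
  · push_cast
    ring

/-- The term `k ^ (-j)`, restricted to odd `k`. -/
noncomputable def oddInvPow (j k : ℕ) : ℂ := if Odd k then 1 / (k : ℂ) ^ j else 0

lemma hasContinuation_oddInvPow (j : ℕ) : HasContinuation (oddInvPow j) :=
  (hasContinuation_odd.div_pow j).congr fun n _ => by
    rw [oddInvPow]
    split_ifs <;> simp

lemma hasContinuation_oddInvPow_add_one (j : ℕ) :
    HasContinuation (fun n => oddInvPow j (n + 1)) :=
  (hasContinuation_even.div_add_pow (c := 1) zero_le_one j).congr fun n _ => by
    rw [oddInvPow]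
    have : Odd (n + 1) ↔ Even n := by simp [parity_simps]
    simp only [this]
    split_ifs <;> simp

lemma norm_one_div_natCast_pow_le (k j : ℕ) : ‖1 / (k : ℂ) ^ j‖ ≤ 1 := by
  rw [norm_div, norm_one, norm_pow, Complex.norm_natCast]
  rcases Nat.eq_zero_or_pos k with rfl | hk
  · rcases Nat.eq_zero_or_pos j with rfl | hj
    · simp
    · simp [hj.ne']
  · refine div_le_one_of_le₀ (one_le_pow₀ ?_) (by positivity)
    exact_mod_cast hk

lemma norm_oddInvPow_le (j k : ℕ) : ‖oddInvPow j k‖ ≤ 1 := by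
  rw [oddInvPow]
  split_ifs
  · exact norm_one_div_natCast_pow_le k j
  · simp

lemma hasContinuation_sum_oddInvPow (j : ℕ) :
    HasContinuation (fun n => ∑ m ∈ Finset.range n, oddInvPow j m) :=
  (hasContinuation_oddInvPow j).of_difference one_ne_zero 1 (fun n _ => norm_oddInvPow_le j n)
    fun n _ => Finset.sum_range_succ _ n

/-- Under n ↦ n + 2 and m ↦ m + 2 the summand is unchanged and parity is kept; only m = 1 is new,
contributing 1 / (n + 1)^j. -/
lemma hasContinuation_sum_odd_sub (j : ℕ) :
    HasContinuation (fun n => ∑ m ∈ Finset.range n, if Odd m then 1 / ((n : ℂ) - m) ^ j else 0) := by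
  refine (hasContinuation_one_div_add_one_pow j).of_difference two_ne_zero 1 (fun n _ => ?_)
    fun n _ => ?_
  · simpa using norm_one_div_natCast_pow_le (n + 1) j
  · rw [Finset.sum_range_succ', Finset.sum_range_succ']
    have h : ∀ m : ℕ, Odd (m + 1 + 1) ↔ Odd m := fun m => by simp [parity_simps]
    simp only [h]
    push_cast
    have e : (n : ℂ) + 2 - (0 + 1) = n + 1 := by ring
    simp only [odd_one, if_true, Nat.not_odd_zero, if_false, add_zero]
    congr 1
    · refine Finset.sum_congr rfl fun m _ => ?_
      ring_nf
    · ring_nf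

/-- Under n ↦ n + 1 and m ↦ m + 2 the summand is unchanged. The term m = 1 is gained and the old
term m = n - 1 is lost, the latter being 1 / (n + 1)^j when n + 1 is odd. -/
lemma hasContinuation_sum_odd_two_mul_sub (j : ℕ) :
    HasContinuation
      (fun n => ∑ m ∈ Finset.range n, if Odd m then 1 / (2 * (n : ℂ) - m) ^ j else 0) := by
  have hg : HasContinuation (fun n => 1 / (2 * (n : ℂ) + 1) ^ j + (-1) * oddInvPow j (n + 1)) :=
    (hasContinuation_one_div_two_mul_add_one_pow j).add
      ((hasContinuation_oddInvPow_add_one j).const_mul (-1))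
  refine hg.of_difference one_ne_zero 2 (fun n _ => ?_) fun n hn => ?_
  · refine (norm_add_le _ _).trans ?_
    have h1 := norm_one_div_natCast_pow_le (2 * n + 1) j
    have h2 := norm_oddInvPow_le j (n + 1)
    push_cast at h1
    rw [norm_mul, norm_neg, norm_one, one_mul]
    linarith
  · obtain ⟨n, rfl⟩ := Nat.exists_eq_succ_of_ne_zero hn
    rw [Nat.succ_eq_add_one, Finset.sum_range_succ', Finset.sum_range_succ',
      Finset.sum_range_succ _ n]
    have h : ∀ m : ℕ, Odd (m + 1 + 1) ↔ Odd m := fun m => by simp [parity_simps]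
    simp only [h, oddInvPow]
    push_cast
    simp only [odd_one, if_true, Nat.not_odd_zero, if_false, add_zero]
    have e1 : ∀ m : ℕ, 2 * ((n : ℂ) + 1 + 1) - (m + 1 + 1) = 2 * (n + 1) - m := fun m => by ring
    have e2 : 2 * ((n : ℂ) + 1) - n = n + 1 + 1 := by ring
    have e3 : 2 * ((n : ℂ) + 1 + 1) - 1 = 2 * (n + 1) + 1 := by ring
    simp only [e1, e2, e3]
    ring

/-- Here n stands for m₁ + m₂; this is the partial fraction identity at x = -m, which accounts for
the sign (-1)^p. -/
lemma hasContinuation_inner_finite (p q r : ℕ) (hp : 1 ≤ p) :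
    HasContinuation (fun n => ∑ m ∈ Finset.range n, if Odd m then
      1 / ((m : ℂ) ^ p * ((n : ℂ) - m) ^ q * (2 * (n : ℂ) - m) ^ r) else 0) := by
  have hA : HasContinuation fun n => ∑ k ∈ Finset.range p, coeffA q r k * (-1) ^ (p - k) *
      ((∑ m ∈ Finset.range n, oddInvPow (p - k) m) / (n : ℂ) ^ (q + r + k)) :=
    .sum fun k _ => ((hasContinuation_sum_oddInvPow _).div_pow _).const_mul _
  have hB : HasContinuation fun n => ∑ k ∈ Finset.range q, coeffB p r k *
      ((∑ m ∈ Finset.range n, if Odd m then 1 / ((n : ℂ) - m) ^ (q - k) else 0) /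
        (n : ℂ) ^ (p + r + k)) :=
    .sum fun k _ => ((hasContinuation_sum_odd_sub _).div_pow _).const_mul _
  have hC : HasContinuation fun n => ∑ k ∈ Finset.range r, coeffC p q k *
      ((∑ m ∈ Finset.range n, if Odd m then 1 / (2 * (n : ℂ) - m) ^ (r - k) else 0) /
        (n : ℂ) ^ (p + q + k)) :=
    .sum fun k _ => ((hasContinuation_sum_odd_two_mul_sub _).div_pow _).const_mul _
  refine (((hA.add hB).add hC).const_mul ((-1) ^ p)).congr fun n hn => ?_
  simp only [Finset.sum_div, Finset.mul_sum]
  rw [Finset.sum_comm, Finset.sum_comm (s := Finset.range q), Finset.sum_comm (s := Finset.range r),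
    ← Finset.sum_add_distrib, ← Finset.sum_add_distrib, Finset.mul_sum]
  refine Finset.sum_congr rfl fun m hm => ?_
  by_cases hodd : Odd m
  · have hmn : m < n := Finset.mem_range.1 hm
    have hm0 : m ≠ 0 := by rintro rfl; simp at hodd
    have hn' : (n : ℂ) ≠ 0 := by exact_mod_cast hn
    have hm' : -(m : ℂ) ≠ 0 := neg_ne_zero.2 (by exact_mod_cast hm0)
    have h1 : -(m : ℂ) + n ≠ 0 := by
      have : -(m : ℤ) + n ≠ 0 := by omega
      exact_mod_cast this
    have h2 : -(m : ℂ) + 2 * n ≠ 0 := by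
      have : -(m : ℤ) + 2 * n ≠ 0 := by omega
      exact_mod_cast this
    have h := partialFraction p q r hp hn' hm' h1 h2
    have hsq : (-1 : ℂ) ^ p * (-1) ^ p = 1 := by rw [← mul_pow]; simp
    simp only [hodd, if_true, oddInvPow]
    have e1 : -(m : ℂ) + n = n - m := by ring
    have e2 : -(m : ℂ) + 2 * n = 2 * n - m := by ring
    rw [e1, e2, neg_pow] at h
    have h3 : 1 / ((m : ℂ) ^ p * ((n : ℂ) - m) ^ q * (2 * (n : ℂ) - m) ^ r) =
        (-1) ^ p * (1 / ((-1) ^ p * (m : ℂ) ^ p * ((n : ℂ) - m) ^ q * (2 * (n : ℂ) - m) ^ r)) := by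
      have : (-1 : ℂ) ^ p ≠ 0 := by simp
      field_simp
    rw [h3, h]
    refine congrArg _ (congrArg₂ (· + ·) (congrArg₂ (· + ·) ?_ ?_) ?_)
    · refine Finset.sum_congr rfl fun k _ => ?_
      rw [neg_pow (m : ℂ)]
      have hsq : (-1 : ℂ) ^ (p - k) * (-1) ^ (p - k) = 1 := by rw [← mul_pow]; simp
      have : (-1 : ℂ) ^ (p - k) ≠ 0 := by simp
      have hm'' : (m : ℂ) ≠ 0 := by exact_mod_cast hm0
      field_simp
      linear_combination coeffA q r k * hsq
    · refine Finset.sum_congr rfl fun k _ => ?_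
      rw [div_div, mul_one_div, mul_comm (_ ^ _)]
    · refine Finset.sum_congr rfl fun k _ => ?_
      rw [div_div, mul_one_div, mul_comm (_ ^ _)]
  · simp [hodd, oddInvPow]

/-- The term `(2 k + 1 + x) ^ (-j)`, made summable over `k` by subtracting `(2 k + 1) ^ (-1)` if
`j = 1`. -/
noncomputable def shiftedTerm (j x k : ℕ) : ℂ :=
  1 / (2 * (k : ℂ) + 1 + x) ^ j - if j = 1 then 1 / (2 * (k : ℂ) + 1) else 0

lemma summable_shiftedTerm {j : ℕ} (hj : 1 ≤ j) (x : ℕ) : Summable (shiftedTerm j x) := by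
  have hs : Summable fun k : ℕ => ((x : ℝ) + 1) * (1 / ((k + 1 : ℕ) : ℝ) ^ 2) :=
    ((summable_nat_add_iff 1).2 (Real.summable_one_div_nat_pow.2 one_lt_two)).mul_left _
  refine Summable.of_norm_bounded hs fun k => ?_
  have h2 : ‖2 * (k : ℂ) + 1 + x‖ = 2 * k + 1 + x := by
    have := Complex.norm_natCast (2 * k + 1 + x)
    push_cast at this
    exact this
  have h3 : ‖2 * (k : ℂ) + 1‖ = 2 * k + 1 := by
    have := Complex.norm_natCast (2 * k + 1)
    push_cast at this
    exact this
  have hk : (0 : ℝ) ≤ k := by positivity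
  have hx : (0 : ℝ) ≤ x := by positivity
  push_cast
  rcases eq_or_ne j 1 with rfl | hj1
  · have : shiftedTerm 1 x k = -(x : ℂ) / ((2 * (k : ℂ) + 1 + x) * (2 * (k : ℂ) + 1)) := by
      have e1 : 2 * (k : ℂ) + 1 + x ≠ 0 := by exact_mod_cast (by omega : 2 * k + 1 + x ≠ 0)
      have e2 : 2 * (k : ℂ) + 1 ≠ 0 := by exact_mod_cast (by omega : 2 * k + 1 ≠ 0)
      simp only [shiftedTerm, if_true, pow_one]
      field_simp
      ring
    rw [this, norm_div, norm_mul, h2, h3, norm_neg, Complex.norm_natCast, mul_one_div, sq]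
    exact div_le_div₀ (by positivity) (by linarith) (by positivity)
      (mul_le_mul (by linarith) (by linarith) (by positivity) (by positivity))
  · rw [shiftedTerm, if_neg hj1, sub_zero, norm_div, norm_one, norm_pow, h2]
    have h4 : ((k : ℝ) + 1) ^ 2 ≤ (2 * k + 1 + x) ^ j :=
      (pow_le_pow_left₀ (by positivity) (by linarith) 2).trans
        (pow_le_pow_right₀ (by linarith) (by omega))
    refine (one_div_le_one_div_of_le (by positivity) h4).trans ?_
    exact le_mul_of_one_le_left (by positivity) (by linarith)

/-- Raising x by 2 is the same as raising k by 1, so the difference telescopes; the subtracted 1 /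
(2k + 1) does not depend on x and drops out. -/
lemma tsum_shiftedTerm_add_two {j : ℕ} (hj : 1 ≤ j) (x : ℕ) :
    ∑' k, shiftedTerm j (x + 2) k = ∑' k, shiftedTerm j x k + -(1 / (1 + (x : ℂ)) ^ j) := by
  set t : ℕ → ℂ := fun k => 1 / (2 * (k : ℂ) + 1 + x) ^ j with ht
  have h1 := (summable_shiftedTerm hj (x + 2)).hasSum.sub (summable_shiftedTerm hj x).hasSum
  have h2 : ∀ N : ℕ, ∑ k ∈ Finset.range N, (shiftedTerm j (x + 2) k - shiftedTerm j x k) =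
      t N - t 0 := by
    intro N
    rw [← Finset.sum_range_sub]
    refine Finset.sum_congr rfl fun k _ => ?_
    simp only [shiftedTerm, ht]
    push_cast
    ring_nf
  have h3 : Tendsto t atTop (𝓝 0) := by
    have h4 : Tendsto (fun k : ℕ => 1 / ((k : ℝ) + 1)) atTop (𝓝 0) :=
      tendsto_one_div_add_atTop_nhds_zero_nat
    refine squeeze_zero_norm (fun k => ?_) h4
    have h5 : ‖2 * (k : ℂ) + 1 + x‖ = 2 * k + 1 + x := by
      have := Complex.norm_natCast (2 * k + 1 + x)
      push_cast at this
      exact this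
    have hk : (0 : ℝ) ≤ k := by positivity
    have hx : (0 : ℝ) ≤ x := by positivity
    rw [ht, norm_div, norm_one, norm_pow, h5]
    refine one_div_le_one_div_of_le (by positivity) ?_
    exact (by linarith : (k : ℝ) + 1 ≤ 2 * k + 1 + x).trans
      (le_self_pow₀ (by linarith) (by omega))
  have h6 := h1.tendsto_sum_nat
  simp only [h2] at h6
  have h7 := tendsto_nhds_unique h6 (h3.sub_const (t 0))
  have h8 : t 0 = 1 / (1 + (x : ℂ)) ^ j := by simp [ht]
  rw [← h8]
  linear_combination h7

lemma hasContinuation_tsum_shiftedTerm {j : ℕ} (hj : 1 ≤ j) :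
    HasContinuation (fun n => ∑' k, shiftedTerm j n k) := by
  refine ((hasContinuation_one_div_add_one_pow j).const_mul (-1)).of_difference two_ne_zero 1
    (fun n _ => ?_) fun n _ => ?_
  · rw [norm_mul, norm_neg, norm_one, one_mul]
    simpa using norm_one_div_natCast_pow_le (n + 1) j
  · rw [tsum_shiftedTerm_add_two hj, add_comm (1 : ℂ)]
    ring

lemma hasContinuation_tsum_shiftedTerm_two_mul {j : ℕ} (hj : 1 ≤ j) :
    HasContinuation (fun n => ∑' k, shiftedTerm j (2 * n) k) := by
  refine ((hasContinuation_one_div_two_mul_add_one_pow j).const_mul (-1)).of_difference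
    one_ne_zero 1 (fun n _ => ?_) fun n _ => ?_
  · rw [norm_mul, norm_neg, norm_one, one_mul]
    simpa using norm_one_div_natCast_pow_le (2 * n + 1) j
  · rw [mul_add, mul_one, tsum_shiftedTerm_add_two hj, add_comm (1 : ℂ)]
    push_cast
    ring

/-- Here n stands for m₂ and 2k + 1 for m₁. The three partial fraction sums may diverge separately;
the terms subtracted in `shiftedTerm` cancel in total because the residues add up to 0. -/
lemma exists_hasContinuation_inner_infinite (p q r : ℕ) (hp : 1 ≤ p) (hq : 1 ≤ q) (hr : 1 ≤ r) :
    ∃ f : ℕ → ℂ, HasContinuation f ∧ ∀ n : ℕ, n ≠ 0 → HasSum (fun k : ℕ =>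
      1 / ((2 * (k : ℂ) + 1) ^ p * (2 * (k : ℂ) + 1 + n) ^ q * (2 * (k : ℂ) + 1 + 2 * n) ^ r))
      (f n) := by
  have hA : HasContinuation fun n => ∑ k ∈ Finset.range p, coeffA q r k *
      ((∑' i, shiftedTerm (p - k) 0 i) / (n : ℂ) ^ (q + r + k)) := by
    refine .sum fun k _ => HasContinuation.const_mul (HasContinuation.div_pow ?_ _) _
    exact (hasContinuation_one.const_mul (∑' i, shiftedTerm (p - k) 0 i)).congr fun n _ => by simp
  have hB : HasContinuation fun n => ∑ k ∈ Finset.range q, coeffB p r k *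
      ((∑' i, shiftedTerm (q - k) n i) / (n : ℂ) ^ (p + r + k)) := by
    refine .sum fun k hk => HasContinuation.const_mul (HasContinuation.div_pow ?_ _) _
    have : k < q := Finset.mem_range.1 hk
    exact hasContinuation_tsum_shiftedTerm (by omega)
  have hC : HasContinuation fun n => ∑ k ∈ Finset.range r, coeffC p q k *
      ((∑' i, shiftedTerm (r - k) (2 * n) i) / (n : ℂ) ^ (p + q + k)) := by
    refine .sum fun k hk => HasContinuation.const_mul (HasContinuation.div_pow ?_ _) _
    have : k < r := Finset.mem_range.1 hk
    exact hasContinuation_tsum_shiftedTerm_two_mul (by omega)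
  refine ⟨_, (hA.add hB).add hC, fun n hn => ?_⟩
  have key : ∀ (l x : ℕ) (a : ℕ → ℂ) (e : ℕ → ℕ), HasSum (fun i : ℕ => ∑ k ∈ Finset.range l,
      a k * (shiftedTerm (l - k) x i / (n : ℂ) ^ (e k)))
      (∑ k ∈ Finset.range l, a k * ((∑' i, shiftedTerm (l - k) x i) / (n : ℂ) ^ (e k))) := by
    intro l x a e
    refine hasSum_sum fun k hk => HasSum.mul_left _ (HasSum.div_const ?_ _)
    have : k < l := Finset.mem_range.1 hk
    exact (summable_shiftedTerm (by omega) x).hasSum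
  convert! ((key p 0 (coeffA q r) _).add (key q n (coeffB p r) _)).add
    (key r (2 * n) (coeffC p q) _) using 1
  funext i
  have hn' : (n : ℂ) ≠ 0 := by exact_mod_cast hn
  have h0 : 2 * (i : ℂ) + 1 ≠ 0 := by exact_mod_cast (by omega : 2 * i + 1 ≠ 0)
  have h1 : 2 * (i : ℂ) + 1 + n ≠ 0 := by exact_mod_cast (by omega : 2 * i + 1 + n ≠ 0)
  have h2 : 2 * (i : ℂ) + 1 + 2 * n ≠ 0 := by exact_mod_cast (by omega : 2 * i + 1 + 2 * n ≠ 0)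
  rw [partialFraction p q r hp hn' h0 h1 h2]
  have hres := coeff_residue_sum p q r hp hq hr n (1 / (2 * (i : ℂ) + 1))
  have split : ∀ (l x : ℕ) (a : ℕ → ℂ) (e : ℕ → ℕ), ∑ k ∈ Finset.range l,
      a k * (shiftedTerm (l - k) x i / (n : ℂ) ^ (e k)) =
      ∑ k ∈ Finset.range l, a k / ((n : ℂ) ^ (e k) * (2 * (i : ℂ) + 1 + x) ^ (l - k)) -
      ∑ k ∈ Finset.range l, a k / (n : ℂ) ^ (e k) *
        (if l - k = 1 then 1 / (2 * (i : ℂ) + 1) else 0) := by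
    intro l x a e
    rw [← Finset.sum_sub_distrib]
    refine Finset.sum_congr rfl fun k _ => ?_
    rw [shiftedTerm, ← div_div]
    ring
  rw [split, split, split]
  push_cast
  rw [add_zero]
  linear_combination hres

end InnerSums

/-! ### Identity theorem and gluing of continuations. -/

section Gluing

open Filter Topology

/-- On a connected half plane, the difference has infinite order at every point as soon as it has at
one. Equality holds only on a punctured neighbourhood, since meromorphic functions here carry
arbitrary values at isolated points. -/
lemma eventuallyEq_of_meromorphicOn {F G : ℂ → ℂ} {σ : ℝ} (hF : MeromorphicOn F {s | σ < s.re})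
    (hG : MeromorphicOn G {s | σ < s.re}) {x : ℝ} (h : ∀ s : ℂ, x < s.re → F s = G s) {s : ℂ}
    (hs : σ < s.re) : F =ᶠ[𝓝[≠] s] G := by
  have hFG : MeromorphicOn (F - G) {s | σ < s.re} := hF.sub hG
  have htop : meromorphicOrderAt (F - G) s = ⊤ := by
    by_contra hne
    set t : ℂ := ((max σ x + 1 : ℝ) : ℂ) with ht
    have hσt : σ < t.re := by
      rw [ht, Complex.ofReal_re]
      linarith [le_max_left σ x]
    have hxt : x < t.re := by
      rw [ht, Complex.ofReal_re]
      linarith [le_max_right σ x]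
    refine hFG.meromorphicOrderAt_ne_top_of_isPreconnected
      (convex_halfSpace_re_gt σ).isPreconnected hs hσt hne ?_
    rw [meromorphicOrderAt_eq_top_iff]
    refine Filter.Eventually.filter_mono nhdsWithin_le_nhds ?_
    filter_upwards [(isOpen_lt continuous_const Complex.continuous_re).mem_nhds hxt] with z hz
    rw [Pi.sub_apply, h z hz, sub_self]
  rw [meromorphicOrderAt_eq_top_iff] at htop
  filter_upwards [htop] with z hz
  exact sub_eq_zero.1 hz

lemma eq_of_meromorphicOn {F G : ℂ → ℂ} {σ : ℝ} (hF : MeromorphicOn F {s | σ < s.re})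
    (hG : MeromorphicOn G {s | σ < s.re}) {x : ℝ} (h : ∀ s : ℂ, x < s.re → F s = G s) {s : ℂ}
    (hs : σ < s.re) (hFs : ContinuousAt F s) (hGs : ContinuousAt G s) : F s = G s := by
  have h1 := eventuallyEq_of_meromorphicOn hF hG h hs
  exact tendsto_nhds_unique_of_eventuallyEq (hFs.tendsto.mono_left nhdsWithin_le_nhds)
    (hGs.tendsto.mono_left nhdsWithin_le_nhds) h1

lemma HasContinuation.exists_meromorphicOn_univ {f : ℕ → ℂ} (hf : HasContinuation f) :
    ∃ F : ℂ → ℂ, MeromorphicOn F Set.univ ∧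
      ∃ x : ℝ, ∀ s : ℂ, x < s.re → F s = LSeries f s := by
  choose F hF x hx using fun K : ℕ => hf.2 (-(K : ℝ))
  refine ⟨fun s => F (⌈-s.re⌉₊ + 1) s, fun s _ => ?_, max 0 (x 1), fun s hs => ?_⟩
  -- Every index used at points within distance 1 of s is at most N, so near s the glued function
  -- agrees with the single function F N off s.
  · set N := ⌈-s.re⌉₊ + 2 with hN
    have hceil : -s.re ≤ ⌈-s.re⌉₊ := Nat.le_ceil _
    have hmem : -(N : ℝ) < s.re := by
      rw [hN]
      push_cast
      linarith
    refine (hF N s hmem).congr ?_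
    have hall : ∀ᶠ z in 𝓝[≠] s, ∀ k ∈ Finset.range (N + 1), -(k : ℝ) < s.re → F N z = F k z := by
      rw [eventually_all_finset]
      intro k hk
      by_cases hks : -(k : ℝ) < s.re
      · have hkN : k ≤ N := Nat.lt_succ_iff.1 (Finset.mem_range.1 hk)
        have hkN' : (k : ℝ) ≤ N := by exact_mod_cast hkN
        have hsub : MeromorphicOn (F N) {z | -(k : ℝ) < z.re} := fun z hz => hF N z (by
          have : -(k : ℝ) < z.re := hz
          change -(N : ℝ) < z.re
          linarith)
        filter_upwards [eventuallyEq_of_meromorphicOn hsub (hF k) (x := max (x N) (x k))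
          (fun z hz => by
            rw [max_lt_iff] at hz
            rw [hx N z hz.1, hx k z hz.2]) hks] with z hz _
        exact hz
      · exact Eventually.of_forall fun z h => absurd h hks
    have hnear : ∀ᶠ z in 𝓝[≠] s, s.re - 1 < z.re ∧ z.re < s.re + 1 := by
      refine Filter.Eventually.filter_mono nhdsWithin_le_nhds ?_
      refine Complex.continuous_re.continuousAt.eventually (Ioo_mem_nhds ?_ ?_) <;> linarith
    filter_upwards [hall, hnear] with z hz hzn
    have h1 : -z.re ≤ ⌈-z.re⌉₊ := Nat.le_ceil _
    have h2 : ⌈-z.re⌉₊ ≤ ⌈-s.re⌉₊ + 1 := by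
      rw [Nat.ceil_le]
      push_cast
      linarith
    refine hz _ ?_ ?_
    · rw [Finset.mem_range]
      omega
    · push_cast
      linarith
  · rw [max_lt_iff] at hs
    have : ⌈-s.re⌉₊ = 0 := Nat.ceil_eq_zero.2 (by linarith)
    simp only [this, zero_add]
    exact hx 1 s hs.2

lemma exists_isMeromorphicContinuation {ι : Type} {u : ℂ → ι → ℂ} {f : ℕ → ℂ}
    (hf : HasContinuation f) (hs : ∀ s : ℂ, 1 < s.re → LSeriesSummable f s)
    (hu : ∀ s : ℂ, 1 < s.re → HasSum (u s) (LSeries f s)) :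
    ∃ F : ℂ → ℂ, IsMeromorphicContinuation u F := by
  obtain ⟨F, hF, x, hx⟩ := hf.exists_meromorphicOn_univ
  have habs : LSeries.abscissaOfAbsConv f ≤ 1 :=
    LSeries.abscissaOfAbsConv_le_of_forall_lt_LSeriesSummable fun y hy => hs y (by simpa using hy)
  have hana : ∀ s : ℂ, 1 < s.re → AnalyticAt ℂ (LSeries f) s := fun s hs =>
    LSeries_analyticOnNhd f s (habs.trans_lt (by exact_mod_cast hs))
  -- F equals the series only far to the right, and elsewhere up to isolated points, whereas a
  -- continuation must have the right value at every s with Re s > 1; hence F is overwritten there.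
  refine ⟨fun s => if 1 < s.re then LSeries f s else F s, fun s _ => ?_, fun s hs => ?_⟩
  · refine (hF s trivial).congr ?_
    filter_upwards [(hF s trivial).eventually_analyticAt] with z hz
    split_ifs with h
    · exact eq_of_meromorphicOn (fun w _ => hF w trivial)
        (fun w hw => (hana w hw).meromorphicAt) hx h hz.continuousAt (hana z h).continuousAt
    · rfl
  · simp only [hs, if_true]
    exact hu s hs

end Gluing

/-! ### Absolute convergence for Re s > 1 and rewriting as Dirichlet series. -/

section Summation

open Filter Topology

lemma norm_natCast_cpow_eq (a : ℕ) (ha : a ≠ 0) (s : ℂ) : ‖(a : ℂ) ^ s‖ = (a : ℝ) ^ s.re := by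
  rw [← Complex.ofReal_natCast, Complex.norm_cpow_eq_rpow_re_of_pos]
  exact_mod_cast Nat.pos_of_ne_zero ha

lemma summable_pnat_rpow {σ : ℝ} (hσ : 1 < σ) : Summable fun n : ℕ+ => 1 / ((n : ℕ) : ℝ) ^ σ :=
  (Real.summable_one_div_nat_rpow.2 hσ).comp_injective PNat.coe_injective

lemma summable_pSp2Index {σ τ : ℝ} (hσ : 1 < σ) (hτ : 1 < τ) :
    Summable fun i : PSp2Index => 1 / ((i.1.1 : ℕ) : ℝ) ^ σ * (1 / ((i.1.2 : ℕ) : ℝ) ^ τ) :=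
  ((summable_pnat_rpow hσ).mul_of_nonneg (summable_pnat_rpow hτ) (fun _ => by positivity)
    (fun _ => by positivity)).comp_injective Subtype.val_injective

lemma summable_zetaPSp2Term_left {p q r : ℕ} (hp : 1 ≤ p) (hq : 1 ≤ q) {s : ℂ} (hs : 1 < s.re) :
    Summable (zetaPSp2Term p s q r) := by
  refine Summable.of_norm_bounded (summable_pSp2Index one_lt_two hs) fun i => ?_
  obtain ⟨⟨⟨a, ha⟩, ⟨b, hb⟩⟩, hi⟩ := i
  simp only [zetaPSp2Term, PNat.mk_coe, Complex.cpow_natCast]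
  have ha1 : (1 : ℝ) ≤ a := by exact_mod_cast ha
  have hb1 : (1 : ℝ) ≤ b := by exact_mod_cast hb
  have e1 : ‖(a : ℂ) + b‖ = a + b := by
    have := Complex.norm_natCast (a + b)
    push_cast at this
    exact this
  have e2 : ‖(a : ℂ) + 2 * b‖ = a + 2 * b := by
    have := Complex.norm_natCast (a + 2 * b)
    push_cast at this
    exact this
  rw [norm_div, norm_one, norm_mul, norm_mul, norm_mul, norm_pow, norm_pow, norm_pow,
    norm_natCast_cpow_eq b (by omega), e1, e2, Complex.norm_natCast, div_mul_div_comm, one_mul]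
  refine one_div_le_one_div_of_le (by positivity) ?_
  rw [Real.rpow_two]
  have h1 : (a : ℝ) ≤ a ^ p := le_self_pow₀ ha1 (by omega)
  have h2 : (a : ℝ) ≤ (a + b) ^ q := by
    refine le_trans ?_ (le_self_pow₀ (by linarith) (by omega))
    linarith
  have h3 : (1 : ℝ) ≤ (a + 2 * b) ^ r := one_le_pow₀ (by linarith)
  calc (a : ℝ) ^ 2 * b ^ s.re = a * b ^ s.re * a * 1 := by ring
    _ ≤ a ^ p * b ^ s.re * (a + b) ^ q * (a + 2 * b) ^ r := by gcongr

/-- Each of the four factors gives one power: a from a^p and (a + b)^s, b from b^q and (a + 2b)^r,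
so the comparison series is ∑ a^(-2) b^(-2). -/
lemma summable_zetaPSp2Term_right {p q r : ℕ} (hp : 1 ≤ p) (hq : 1 ≤ q) (hr : 1 ≤ r) {s : ℂ}
    (hs : 1 < s.re) : Summable (zetaPSp2Term p q s r) := by
  refine Summable.of_norm_bounded (summable_pSp2Index one_lt_two one_lt_two) fun i => ?_
  obtain ⟨⟨⟨a, ha⟩, ⟨b, hb⟩⟩, hi⟩ := i
  simp only [zetaPSp2Term, PNat.mk_coe, Complex.cpow_natCast]
  have ha1 : (1 : ℝ) ≤ a := by exact_mod_cast ha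
  have hb1 : (1 : ℝ) ≤ b := by exact_mod_cast hb
  have e1 : ‖((a : ℂ) + b) ^ s‖ = (a + b : ℝ) ^ s.re := by
    have := norm_natCast_cpow_eq (a + b) (by omega) s
    push_cast at this
    exact this
  have e2 : ‖(a : ℂ) + 2 * b‖ = a + 2 * b := by
    have := Complex.norm_natCast (a + 2 * b)
    push_cast at this
    exact this
  rw [norm_div, norm_one, norm_mul, norm_mul, norm_mul, norm_pow, norm_pow, norm_pow,
    e1, e2, Complex.norm_natCast, Complex.norm_natCast, div_mul_div_comm, one_mul]
  refine one_div_le_one_div_of_le (by positivity) ?_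
  rw [Real.rpow_two, Real.rpow_two]
  have h1 : (a : ℝ) ≤ a ^ p := le_self_pow₀ ha1 (by omega)
  have h2 : (b : ℝ) ≤ b ^ q := le_self_pow₀ hb1 (by omega)
  have h3 : (a : ℝ) ≤ (a + b) ^ s.re := by
    refine le_trans ?_ (Real.self_le_rpow_of_one_le (by linarith) hs.le)
    linarith
  have h4 : (b : ℝ) ≤ (a + 2 * b) ^ r := by
    refine le_trans ?_ (le_self_pow₀ (by linarith) (by omega))
    linarith
  calc (a : ℝ) ^ 2 * b ^ 2 = a * b * a * b := by ring
    _ ≤ a ^ p * b ^ q * (a + b) ^ s.re * (a + 2 * b) ^ r := by gcongr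

lemma PSp2Index.odd (i : PSp2Index) : Odd (i.1.1 : ℕ) :=
  Nat.odd_iff.2 i.2

/-- The index with components `a` and `b`. -/
def PSp2Index.mk' (a b : ℕ) (ha : Odd a) (hb : 0 < b) : PSp2Index :=
  ⟨(⟨a, ha.pos⟩, ⟨b, hb⟩), Nat.odd_iff.1 ha⟩

lemma PSp2Index.ext' {i j : PSp2Index} (h1 : (i.1.1 : ℕ) = j.1.1) (h2 : (i.1.2 : ℕ) = j.1.2) :
    i = j :=
  Subtype.ext (Prod.ext (PNat.coe_injective h1) (PNat.coe_injective h2))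

lemma exists_continuation_left {p q r : ℕ} (hp : 1 ≤ p) (hq : 1 ≤ q) (hr : 1 ≤ r) :
    ∃ F : ℂ → ℂ, IsMeromorphicContinuation (fun s => zetaPSp2Term p s q r) F := by
  obtain ⟨f, hf, hsum⟩ := exists_hasContinuation_inner_infinite p q r hp hq hr
  have key : ∀ s : ℂ, 1 < s.re → LSeriesHasSum f s (∑' i, zetaPSp2Term p s q r i) := by
    intro s hs
    -- The first coordinate is the Dirichlet variable m₂; the second is k in m₁ = 2k + 1.
    set φ : PSp2Index → ℕ × ℕ := fun i => (i.1.2, (i.1.1 : ℕ) / 2) with hφ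
    set Ψ : ℕ × ℕ → ℂ := fun x => if x.1 = 0 then 0 else
      1 / ((2 * (x.2 : ℂ) + 1) ^ p * (2 * (x.2 : ℂ) + 1 + x.1) ^ q *
        (2 * (x.2 : ℂ) + 1 + 2 * x.1) ^ r) / (x.1 : ℂ) ^ s with hΨ
    have hinj : Function.Injective φ := by
      intro i j hij
      rw [hφ, Prod.mk.injEq] at hij
      have hi := i.odd
      have hj := j.odd
      rw [Nat.odd_iff] at hi hj
      exact PSp2Index.ext' (by omega) hij.1
    have hcomp : Ψ ∘ φ = zetaPSp2Term p s q r := by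
      funext i
      obtain ⟨k, hk⟩ := i.odd
      have hb : (i.1.2 : ℕ) ≠ 0 := i.1.2.ne_zero
      have hk2 : (i.1.1 : ℕ) / 2 = k := by omega
      have hkc : ((i.1.1 : ℕ) : ℂ) = 2 * k + 1 := by rw [hk]; push_cast; rfl
      simp only [hΨ, hφ, Function.comp_apply, zetaPSp2Term, hb, if_false, hk2, hkc,
        Complex.cpow_natCast]
      rw [div_div]
      congr 1
      ring
    have hS := (summable_zetaPSp2Term_left (r := r) hp hq hs).hasSum
    rw [← hcomp, hinj.hasSum_iff] at hS
    · rw [← hcomp]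
      refine hS.prod_fiberwise fun n => ?_
      by_cases hn : n = 0
      · simp only [hΨ, hn, if_true, LSeries.term_zero]
        exact hasSum_zero
      · simp only [hΨ, hn, if_false]
        rw [LSeries.term_of_ne_zero hn]
        exact (hsum n hn).div_const _
    · rintro ⟨n, k⟩ hnk
      by_cases hn : n = 0
      · simp [hΨ, hn]
      · exfalso
        refine hnk ⟨PSp2Index.mk' (2 * k + 1) n ⟨k, rfl⟩ (Nat.pos_of_ne_zero hn), ?_⟩
        simp only [hφ, PSp2Index.mk', PNat.mk_coe, Prod.mk.injEq, true_and]
        omega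
  refine exists_isMeromorphicContinuation hf (fun s hs => (key s hs).LSeriesSummable)
    fun s hs => ?_
  rw [(key s hs).LSeries_eq]
  exact (summable_zetaPSp2Term_left hp hq hs).hasSum

lemma exists_continuation_right {p q r : ℕ} (hp : 1 ≤ p) (hq : 1 ≤ q) (hr : 1 ≤ r) :
    ∃ F : ℂ → ℂ, IsMeromorphicContinuation (fun s => zetaPSp2Term p q s r) F := by
  set f : ℕ → ℂ := fun n => ∑ m ∈ Finset.range n, if Odd m then
      1 / ((m : ℂ) ^ p * ((n : ℂ) - m) ^ q * (2 * (n : ℂ) - m) ^ r) else 0 with hfdef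
  have hf : HasContinuation f := hasContinuation_inner_finite p q r hp
  have key : ∀ s : ℂ, 1 < s.re → LSeriesHasSum f s (∑' i, zetaPSp2Term p q s r i) := by
    intro s hs
    -- The Dirichlet variable is now m₁ + m₂, so each fibre is finite.
    set φ : PSp2Index → ℕ × ℕ := fun i => (i.1.1 + i.1.2, i.1.1) with hφ
    set Ψ : ℕ × ℕ → ℂ := fun x => if Odd x.2 ∧ x.2 < x.1 then
      1 / ((x.2 : ℂ) ^ p * ((x.1 : ℂ) - x.2) ^ q * (2 * (x.1 : ℂ) - x.2) ^ r) / (x.1 : ℂ) ^ s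
      else 0 with hΨ
    have hinj : Function.Injective φ := by
      intro i j hij
      rw [hφ, Prod.mk.injEq] at hij
      exact PSp2Index.ext' hij.2 (by omega)
    have hcomp : Ψ ∘ φ = zetaPSp2Term p q s r := by
      funext i
      have hb : 0 < (i.1.2 : ℕ) := i.1.2.pos
      have hcond : Odd (i.1.1 : ℕ) ∧ (i.1.1 : ℕ) < i.1.1 + i.1.2 := ⟨i.odd, by omega⟩
      simp only [hΨ, hφ, Function.comp_apply, zetaPSp2Term, hcond, if_true,
        Complex.cpow_natCast, and_self]
      rw [div_div]
      push_cast
      rw [add_sub_cancel_left, show 2 * (((i.1.1 : ℕ) : ℂ) + (i.1.2 : ℕ)) - (i.1.1 : ℕ) =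
        (i.1.1 : ℕ) + 2 * (i.1.2 : ℕ) by ring]
      congr 1
      ring
    have hS := (summable_zetaPSp2Term_right hp hq hr hs).hasSum
    rw [← hcomp, hinj.hasSum_iff] at hS
    · rw [← hcomp]
      refine hS.prod_fiberwise fun n => ?_
      have h1 : HasSum (fun m => Ψ (n, m)) (∑ m ∈ Finset.range n, Ψ (n, m)) := by
        refine hasSum_sum_of_ne_finset_zero fun m hm => ?_
        rw [Finset.mem_range] at hm
        simp [hΨ, hm]
      convert! h1 using 1
      by_cases hn : n = 0
      · simp [hn]
      · rw [LSeries.term_of_ne_zero hn, hfdef, Finset.sum_div]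
        refine Finset.sum_congr rfl fun m hm => ?_
        have hmn : m < n := Finset.mem_range.1 hm
        by_cases hodd : Odd m <;> simp [hΨ, hmn, hodd]
    · rintro ⟨n, m⟩ hnm
      by_cases hc : Odd m ∧ m < n
      · exfalso
        refine hnm ⟨PSp2Index.mk' m (n - m) hc.1 (by omega), ?_⟩
        simp only [hφ, PSp2Index.mk', PNat.mk_coe, Prod.mk.injEq, and_true]
        omega
      · simp only [hΨ, hc, if_false]
  refine exists_isMeromorphicContinuation hf (fun s hs => (key s hs).LSeriesSummable)
    fun s hs => ?_
  rw [(key s hs).LSeries_eq]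
  exact (summable_zetaPSp2Term_right hp hq hr hs).hasSum

end Summation

/-! ### Summation over n and identification of the explicit term. -/

section ExplicitTerm

open Filter Topology

lemma hasSum_natCast_cpow_neg {S : ℂ} (hS : 1 < S.re) :
    HasSum (fun n : ℕ => if n = 0 then 0 else 1 / (n : ℂ) ^ S) (riemannZeta S) := by
  have hS0 : S ≠ 0 := by
    rintro rfl
    simp at hS
    linarith
  rw [zeta_eq_tsum_one_div_nat_cpow hS]
  convert! (Complex.summable_one_div_nat_cpow.2 hS).hasSum using 1
  funext n
  split_ifs with h
  · simp [h, Complex.zero_cpow hS0]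
  · rfl

/-- Since 1 + (-1)^n is twice the indicator of even n, adding ζ(S) leaves 2 · 2^(-S) ζ(S). -/
lemma hasSum_neg_one_pow_mul_natCast_cpow_neg {S : ℂ} (hS : 1 < S.re) :
    HasSum (fun n : ℕ => if n = 0 then 0 else (-1) ^ n / (n : ℂ) ^ S)
      (((2 : ℂ) ^ (1 - S) - 1) * riemannZeta S) := by
  have h1 := hasSum_natCast_cpow_neg hS
  have h2 : HasSum (fun n : ℕ => if n = 0 then 0 else (1 + (-1) ^ n) / (n : ℂ) ^ S)
      ((2 : ℂ) ^ (1 - S) * riemannZeta S) := by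
    have hinj : Function.Injective (fun m : ℕ => 2 * m) := fun a b h => by
      have : 2 * a = 2 * b := h
      omega
    rw [← hinj.hasSum_iff]
    · convert! h1.mul_left ((2 : ℂ) ^ (1 - S)) using 1
      funext m
      by_cases hm : m = 0
      · simp [hm]
      · have h2m : 2 * m ≠ 0 := by omega
        simp only [Function.comp_apply, h2m, hm, if_false]
        rw [Even.neg_one_pow ⟨m, by ring⟩, Nat.cast_mul, Complex.natCast_mul_natCast_cpow,
          Complex.cpow_sub _ _ two_ne_zero, Complex.cpow_one]
        push_cast
        rw [div_mul_div_comm, mul_one]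
        norm_num
    · intro n hn
      have hodd : Odd n := by
        rw [← Nat.not_even_iff_odd]
        rintro ⟨m, rfl⟩
        exact hn ⟨m, by simp [two_mul]⟩
      simp [hodd.neg_one_pow]
  convert! h2.sub h1 using 1
  · funext n
    split_ifs
    · simp
    · ring
  · ring

/-- The summand of index `ξ = j` of the explicit term, up to its rational coefficient. -/
noncomputable def zetaFactor (σ : ℂ) (j : ℕ) (S : ℂ) : ℂ :=
  (2 * (Real.pi : ℂ) * Complex.I) ^ j / (j.factorial : ℂ) * riemannZeta S *
    ((bernoulliValue j 0 - σ * bernoulliValue j (1 / 2)) / 2)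

lemma hasSum_parityWeight_one (j l : ℕ) {s : ℂ} (hs : 1 < s.re) :
    HasSum (fun n : ℕ => if n = 0 then 0 else parityWeight 1 j / (n : ℂ) ^ l / (n : ℂ) ^ s)
      (-zetaFactor 1 j (s + l)) := by
  have hS : 1 < (s + l).re := by
    have : (0 : ℝ) ≤ l := by positivity
    simp
    linarith
  convert! (hasSum_natCast_cpow_neg hS).mul_left (parityWeight 1 j) using 1
  · funext n
    split_ifs with h
    · simp
    · have hn : (n : ℂ) ≠ 0 := by exact_mod_cast h
      rw [Complex.cpow_add _ _ hn, Complex.cpow_natCast, div_div, mul_one_div, mul_comm]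
  · rw [zetaFactor, parityWeight]
    ring

/-- Only the B_j(1/2) part carries (-1)^n, which is why the factor 2^(1 - S) - 1 multiplies that
Bernoulli value alone. -/
lemma hasSum_parityWeight_neg_one_pow (j l : ℕ) {s : ℂ} (hs : 1 < s.re) :
    HasSum (fun n : ℕ => if n = 0 then 0 else
      parityWeight ((-1) ^ n) j / (n : ℂ) ^ l / (n : ℂ) ^ s)
      (-zetaFactor ((2 : ℂ) ^ (1 - (s + l)) - 1) j (s + l)) := by
  have hS : 1 < (s + l).re := by
    have : (0 : ℝ) ≤ l := by positivity
    simp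
    linarith
  convert! ((hasSum_natCast_cpow_neg hS).mul_left
      (-((2 * (Real.pi : ℂ) * Complex.I) ^ j / (j.factorial : ℂ)) * bernoulliValue j 0 / 2)).add
    ((hasSum_neg_one_pow_mul_natCast_cpow_neg hS).mul_left
      ((2 * (Real.pi : ℂ) * Complex.I) ^ j / (j.factorial : ℂ) * bernoulliValue j (1 / 2) / 2))
    using 1
  · funext n
    split_ifs with h
    · simp
    · have hn : (n : ℂ) ≠ 0 := by exact_mod_cast h
      rw [Complex.cpow_add _ _ hn, Complex.cpow_natCast, div_div, parityWeight]
      ring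
  · rw [zetaFactor]
    ring

lemma sum_range_add_one_reflect (f : ℕ → ℂ) (p : ℕ) :
    ∑ ξ ∈ Finset.range (p + 1), f ξ = ∑ k ∈ Finset.range (p + 1), f (p - k) := by
  rw [← Finset.sum_range_reflect]
  refine Finset.sum_congr rfl fun k _ => ?_
  rw [Nat.add_sub_cancel]

lemma neg_one_zpow_natCast_sub (a b : ℕ) : (-1 : ℂ) ^ ((a : ℤ) - (b : ℤ)) = (-1) ^ (a + b) := by
  rw [zpow_sub₀ (by norm_num), zpow_natCast, zpow_natCast, pow_add, div_eq_mul_inv, ← inv_pow]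
  norm_num

/-- The index ξ is the exponent of the inverse power, that is p - k, q - k or r - k, where k numbers
the Laurent coefficient; the last two explicit sums together form `coeffC`. -/
lemma zetaPSp2Explicit_eq {p q r : ℕ} (hp : 1 ≤ p) (hq : 1 ≤ q) (s : ℂ) :
    zetaPSp2Explicit p q r s =
      ∑ k ∈ Finset.range (p + 1), coeffA q r k * zetaFactor 1 (p - k) (s + (q + r + k : ℕ)) +
      ∑ k ∈ Finset.range (q + 1), coeffB p r k *
        zetaFactor ((2 : ℂ) ^ (1 - (s + (p + r + k : ℕ))) - 1) (q - k) (s + (p + r + k : ℕ)) +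
      ∑ k ∈ Finset.range (r + 1), coeffC p q k *
        zetaFactor 1 (r - k) (s + (p + q + k : ℕ)) := by
  obtain ⟨p, rfl⟩ := Nat.exists_eq_add_of_le' hp
  obtain ⟨q, rfl⟩ := Nat.exists_eq_add_of_le' hq
  rw [zetaPSp2Explicit, add_assoc (_ + _), ← Finset.sum_add_distrib]
  refine congrArg₂ (· + ·) (congrArg₂ (· + ·) ?_ ?_) ?_
  · rw [sum_range_add_one_reflect]
    refine Finset.sum_congr rfl fun k hk => ?_
    have hk' : k ≤ p + 1 := Nat.lt_succ_iff.1 (Finset.mem_range.1 hk)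
    obtain ⟨j, hj⟩ := Nat.exists_eq_add_of_le hk'
    rw [coeffA_eq, Finset.sum_mul, Nat.sub_sub_self hk', zetaFactor]
    refine Finset.sum_congr rfl fun ω hω => ?_
    have hω' : ω ≤ k := Nat.lt_succ_iff.1 (Finset.mem_range.1 hω)
    have hjp : p + 1 - k = j := by omega
    rw [hjp, neg_one_zpow_natCast_sub, hj, show k + j + j = k + 2 * j by ring, pow_add _ k (2 * j),
      pow_mul, show k + j + (q + 1) - 1 - j - ω = q + k - ω by omega, Nat.add_sub_cancel]
    have e : s + ((k + j : ℕ) : ℂ) + ((q + 1 : ℕ) : ℂ) + r - j = s + (q + 1 + r + k : ℕ) := by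
      push_cast
      ring
    rw [e]
    norm_num
    ring
  · rw [sum_range_add_one_reflect]
    refine Finset.sum_congr rfl fun k hk => ?_
    have hk' : k ≤ q + 1 := Nat.lt_succ_iff.1 (Finset.mem_range.1 hk)
    obtain ⟨j, hj⟩ := Nat.exists_eq_add_of_le hk'
    rw [coeffB_eq, Finset.sum_mul, Nat.sub_sub_self hk', zetaFactor]
    refine Finset.sum_congr rfl fun ω hω => ?_
    have hω' : ω ≤ k := Nat.lt_succ_iff.1 (Finset.mem_range.1 hω)
    have hjp : q + 1 - k = j := by omega
    rw [hjp, neg_one_zpow_natCast_sub, hj,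
      show p + 1 + (k + j) - 1 - j - ω = p + k - ω by omega, Nat.add_sub_cancel]
    have e : s + ((p + 1 : ℕ) : ℂ) + ((k + j : ℕ) : ℂ) + r - j = s + (p + 1 + r + k : ℕ) := by
      push_cast
      ring
    have e2 : 1 - s - ((p + 1 : ℕ) : ℂ) - ((k + j : ℕ) : ℂ) - r + j =
        1 - (s + (p + 1 + r + k : ℕ)) := by
      push_cast
      ring
    rw [e, e2]
    ring
  · rw [sum_range_add_one_reflect]
    refine Finset.sum_congr rfl fun k hk => ?_
    have hk' : k ≤ r := Nat.lt_succ_iff.1 (Finset.mem_range.1 hk)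
    obtain ⟨j, rfl⟩ := Nat.exists_eq_add_of_le hk'
    rw [coeffC_eq, add_mul, Finset.sum_mul, Finset.sum_mul, zetaFactor]
    have e : s + ((p + 1 : ℕ) : ℂ) + ((q + 1 : ℕ) : ℂ) + ((k + j : ℕ) : ℂ) - (j : ℕ) =
        s + (p + 1 + (q + 1) + k : ℕ) := by
      push_cast
      ring
    rw [Nat.add_sub_cancel_left, e]
    refine congrArg₂ (· + ·) ?_ ?_
    · refine Finset.sum_congr rfl fun ω hω => ?_
      rw [show ω + (k + j) - j = ω + k by omega, show k + j - j = k by omega, Nat.add_sub_cancel,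
        show p + 1 + (q + 1) - 2 - ω = p + q - ω by omega]
      ring
    · refine Finset.sum_congr rfl fun ω hω => ?_
      rw [show ω + (k + j) - j = ω + k by omega, Nat.add_sub_cancel,
        show p + 1 + (q + 1) - 2 - ω = p + q - ω by omega, zpow_add₀ (by norm_num),
        neg_one_zpow_natCast_sub]
      ring

end ExplicitTerm

/-! ### The functional relation in the half plane of convergence. -/

section FunctionalRelation

open Filter Topology

/-- The summand of the sum of the four series, indexed by the base `n` of the power `n ^ (-s)`
and an odd integer `m`. -/
noncomputable def combinedTerm (p q r : ℕ) (s : ℂ) (x : ℕ × ℤ) : ℂ :=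
  if x.1 = 0 then 0 else oddTerm p q r x.1 x.2 / (x.1 : ℂ) ^ s

lemma hasSum_combinedTerm_indicator (p q r : ℕ) (s : ℂ) (φ : PSp2Index → ℕ × ℤ)
    (hφ : Function.Injective φ) (c : ℂ) {u : PSp2Index → ℂ} {a : ℂ} (hu : HasSum u a)
    (h : ∀ i, combinedTerm p q r s (φ i) = c * u i) :
    HasSum (Set.indicator (Set.range φ) (combinedTerm p q r s)) (c * a) := by
  have h' : HasSum (combinedTerm p q r s ∘ φ) (c * a) := by
    rw [show combinedTerm p q r s ∘ φ = fun i => c * u i from funext h]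
    exact hu.mul_left c
  rw [← hasSum_subtype_iff_indicator]
  exact hφ.hasSum_range_iff.2 h'

/-- The four maps that send an index of each of the four series to an index of the combined
series. -/
def combinedIndex (t : Fin 4) (i : PSp2Index) : ℕ × ℤ :=
  match t with
  | 0 => (i.1.2, ((i.1.1 : ℕ) : ℤ))
  | 1 => (i.1.1 + i.1.2, -((i.1.1 : ℕ) : ℤ))
  | 2 => (i.1.1 + i.1.2, -((i.1.1 : ℕ) : ℤ) - 2 * ((i.1.2 : ℕ) : ℤ))
  | 3 => (i.1.2, -((i.1.1 : ℕ) : ℤ) - 2 * ((i.1.2 : ℕ) : ℤ))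

lemma combinedIndex_injective (t : Fin 4) : Function.Injective (combinedIndex t) := by
  intro i j hij
  fin_cases t <;> simp only [combinedIndex, Prod.mk.injEq] at hij <;>
    exact PSp2Index.ext' (by omega) (by omega)

lemma mem_range_combinedIndex (t : Fin 4) (n : ℕ) (m : ℤ) :
    (n, m) ∈ Set.range (combinedIndex t) ↔ n ≠ 0 ∧ Odd m ∧
      match t with
      | 0 => 0 < m
      | 1 => -(n : ℤ) < m ∧ m < 0
      | 2 => -(2 * n : ℤ) < m ∧ m < -n
      | 3 => m < -(2 * n : ℤ) := by
  constructor
  · rintro ⟨i, hi⟩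
    have h1 := i.1.1.pos
    have h2 := i.1.2.pos
    have h3 := i.odd
    rw [Nat.odd_iff] at h3
    rw [Int.odd_iff]
    fin_cases t <;> simp only [combinedIndex, Prod.mk.injEq] at hi ⊢ <;> omega
  · rintro ⟨hn, hm, h⟩
    rw [Int.odd_iff] at hm
    fin_cases t <;> simp only at h
    · exact ⟨PSp2Index.mk' m.natAbs n (by rw [Nat.odd_iff]; omega) (by omega), by
        simp only [combinedIndex, PSp2Index.mk', PNat.mk_coe, Prod.mk.injEq, true_and]; omega⟩
    · exact ⟨PSp2Index.mk' m.natAbs (n - m.natAbs) (by rw [Nat.odd_iff]; omega) (by omega), by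
        simp only [combinedIndex, PSp2Index.mk', PNat.mk_coe, Prod.mk.injEq]; omega⟩
    · exact ⟨PSp2Index.mk' (2 * n + m).natAbs (n - (2 * n + m).natAbs)
        (by rw [Nat.odd_iff]; omega) (by omega), by
        simp only [combinedIndex, PSp2Index.mk', PNat.mk_coe, Prod.mk.injEq]; omega⟩
    · exact ⟨PSp2Index.mk' (2 * n + m).natAbs n (by rw [Nat.odd_iff]; omega) (by omega), by
        simp only [combinedIndex, PSp2Index.mk', PNat.mk_coe, Prod.mk.injEq, true_and]; omega⟩

/-- The only odd m outside the four ranges is m = -n, where the term is 0 because q ≥ 1 makes the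
denominator vanish. -/
lemma combinedTerm_eq_sum_indicator (p q r : ℕ) (hq : 1 ≤ q) (s : ℂ) :
    combinedTerm p q r s = fun x =>
      ∑ t : Fin 4, Set.indicator (Set.range (combinedIndex t)) (combinedTerm p q r s) x := by
  classical
  funext ⟨n, m⟩
  simp only [Fin.sum_univ_four, Set.indicator_apply, mem_range_combinedIndex]
  by_cases hn : n = 0
  · simp [hn, combinedTerm]
  by_cases hm : Odd m
  · have hm' := hm
    rw [Int.odd_iff] at hm'
    have hcases : 0 < m ∨ (-(n : ℤ) < m ∧ m < 0) ∨ (-(2 * n : ℤ) < m ∧ m < -n) ∨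
        m < -(2 * n : ℤ) ∨ m = -n := by omega
    simp only [ne_eq, hn, not_false_eq_true, hm, true_and]
    rcases hcases with h | h | h | h | h
    · rw [if_pos h, if_neg (by omega), if_neg (by omega), if_neg (by omega)]
      ring
    · rw [if_neg (by omega), if_pos h, if_neg (by omega), if_neg (by omega)]
      ring
    · rw [if_neg (by omega), if_neg (by omega), if_pos h, if_neg (by omega)]
      ring
    · rw [if_neg (by omega), if_neg (by omega), if_neg (by omega), if_pos h]
      ring
    · rw [if_neg (by omega), if_neg (by omega), if_neg (by omega), if_neg (by omega)]
      simp [combinedTerm, oddTerm, h, show q ≠ 0 by omega]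
  · simp [hm, combinedTerm, oddTerm]

lemma combinedTerm_combinedIndex (p q r : ℕ) (s : ℂ) (i : PSp2Index) :
    combinedTerm p q r s (combinedIndex 0 i) = 1 * zetaPSp2Term p s q r i ∧
    combinedTerm p q r s (combinedIndex 1 i) = (-1) ^ p * zetaPSp2Term p q s r i ∧
    combinedTerm p q r s (combinedIndex 2 i) = (-1) ^ (p + q) * zetaPSp2Term r q s p i ∧
    combinedTerm p q r s (combinedIndex 3 i) = (-1) ^ (p + q + r) * zetaPSp2Term r s q p i := by
  have hodd : Odd ((i.1.1 : ℕ) : ℤ) := by exact_mod_cast i.odd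
  have hodd1 : Odd (-((i.1.1 : ℕ) : ℤ)) := hodd.neg
  have hodd2 : Odd (-((i.1.1 : ℕ) : ℤ) - 2 * ((i.1.2 : ℕ) : ℤ)) :=
    hodd1.sub_even (even_two_mul _)
  have hb : (i.1.2 : ℕ) ≠ 0 := i.1.2.ne_zero
  have hab : (i.1.1 : ℕ) + (i.1.2 : ℕ) ≠ 0 := by omega
  have hc : ∀ (k : ℕ) (D Z : ℂ), D = (-1) ^ k * Z → 1 / D = (-1) ^ k * (1 / Z) := by
    rintro k D Z rfl
    rw [one_div, mul_inv, ← inv_pow, one_div]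
    norm_num
  simp only [combinedTerm, combinedIndex, zetaPSp2Term, hb, hab, if_false, oddTerm, hodd, hodd1,
    hodd2, if_true, Complex.cpow_natCast]
  push_cast
  generalize ((i.1.1 : ℕ) : ℂ) = a
  generalize ((i.1.2 : ℕ) : ℂ) = b
  refine ⟨?_, ?_, ?_, ?_⟩
  · rw [div_div, one_mul]
    congr 1
    ring
  · rw [show -a + (a + b) = b by ring, show -a + 2 * (a + b) = a + 2 * b by ring, div_div]
    exact hc _ _ _ (by rw [neg_pow a]; ring)
  · rw [show -a - 2 * b = -(a + 2 * b) by ring, show -(a + 2 * b) + (a + b) = -b by ring,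
      show -(a + 2 * b) + 2 * (a + b) = a by ring, div_div]
    exact hc _ _ _ (by rw [neg_pow b, neg_pow (a + 2 * b), pow_add]; ring)
  · rw [show -a - 2 * b = -(a + 2 * b) by ring, show -(a + 2 * b) + b = -(a + b) by ring,
      show -(a + 2 * b) + 2 * b = -a by ring, div_div]
    exact hc _ _ _ (by
      rw [neg_pow a, neg_pow (a + b), neg_pow (a + 2 * b), pow_add, pow_add]; ring)

lemma functional_relation_of_one_lt_re {p q r : ℕ} (hp : 1 ≤ p) (hq : 1 ≤ q) (hr : 1 ≤ r) {s : ℂ}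
    (hs : 1 < s.re) {a₁ a₂ a₃ a₄ : ℂ} (h₁ : HasSum (zetaPSp2Term p s q r) a₁)
    (h₂ : HasSum (zetaPSp2Term p q s r) a₂) (h₃ : HasSum (zetaPSp2Term r q s p) a₃)
    (h₄ : HasSum (zetaPSp2Term r s q p) a₄) :
    a₁ + (-1 : ℂ) ^ p * a₂ + (-1 : ℂ) ^ (p + q) * a₃ + (-1 : ℂ) ^ (p + q + r) * a₄ +
      zetaPSp2Explicit p q r s = 0 := by
  have hT := combinedTerm_combinedIndex p q r s
  have hind := fun t => hasSum_combinedTerm_indicator p q r s (combinedIndex t)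
    (combinedIndex_injective t)
  have htot : HasSum (combinedTerm p q r s)
      (1 * a₁ + (-1 : ℂ) ^ p * a₂ + (-1 : ℂ) ^ (p + q) * a₃ + (-1 : ℂ) ^ (p + q + r) * a₄) := by
    rw [combinedTerm_eq_sum_indicator p q r hq s]
    simp only [Fin.sum_univ_four]
    exact (((hind 0 _ h₁ fun i => (hT i).1).add (hind 1 _ h₂ fun i => (hT i).2.1)).add
      (hind 2 _ h₃ fun i => (hT i).2.2.1)).add (hind 3 _ h₄ fun i => (hT i).2.2.2)
  set X : ℕ → ℂ := fun n => ∑ k ∈ Finset.range (p + 1), coeffA q r k / (n : ℂ) ^ (q + r + k) *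
      parityWeight 1 (p - k) +
    ∑ k ∈ Finset.range (q + 1), coeffB p r k / (n : ℂ) ^ (p + r + k) *
      parityWeight ((-1) ^ n) (q - k) +
    ∑ k ∈ Finset.range (r + 1), coeffC p q k / (n : ℂ) ^ (p + q + k) *
      parityWeight 1 (r - k) with hX
  have hfib : ∀ n : ℕ, HasSum (fun m => combinedTerm p q r s (n, m))
      (if n = 0 then 0 else X n / (n : ℂ) ^ s) := by
    intro n
    have hsm : Summable fun m => combinedTerm p q r s (n, m) := htot.summable.prod_factor n
    by_cases hn : n = 0
    · simp only [combinedTerm, hn, if_true]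
      exact hasSum_zero
    -- Absolute convergence of the double series makes each fibre summable, so its sum may be
    -- computed along symmetric intervals.
    · have h1 := hsm.hasSum.comp (Finset.tendsto_Icc_neg (R := ℤ))
      have h2 := (tendsto_sum_oddTerm p q r hp hq hr hn).div_const ((n : ℂ) ^ s)
      have h3 : ∑' m, combinedTerm p q r s (n, m) = X n / (n : ℂ) ^ s := by
        refine tendsto_nhds_unique h1 (h2.congr fun M => ?_)
        simp only [Function.comp_apply, combinedTerm, hn, if_false, Finset.sum_div]
      rw [if_neg hn, ← h3]
      exact hsm.hasSum
  have hout := htot.prod_fiberwise hfib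
  have hexp : HasSum (fun n : ℕ => if n = 0 then 0 else X n / (n : ℂ) ^ s)
      (-zetaPSp2Explicit p q r s) := by
    have hA : HasSum _ _ := hasSum_sum fun k (_ : k ∈ Finset.range (p + 1)) =>
      (hasSum_parityWeight_one (p - k) (q + r + k) hs).mul_left (coeffA q r k)
    have hB : HasSum _ _ := hasSum_sum fun k (_ : k ∈ Finset.range (q + 1)) =>
      (hasSum_parityWeight_neg_one_pow (q - k) (p + r + k) hs).mul_left (coeffB p r k)
    have hC : HasSum _ _ := hasSum_sum fun k (_ : k ∈ Finset.range (r + 1)) =>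
      (hasSum_parityWeight_one (r - k) (p + q + k) hs).mul_left (coeffC p q k)
    convert! (hA.add hB).add hC using 1
    · funext n
      by_cases hn : n = 0
      · simp [hn]
      · simp only [hn, if_false, hX, add_div, Finset.sum_div]
        refine congrArg₂ (· + ·) (congrArg₂ (· + ·) ?_ ?_) ?_ <;>
          exact Finset.sum_congr rfl fun k _ => by ring
    · rw [zetaPSp2Explicit_eq hp hq]
      simp only [mul_neg, Finset.sum_neg_distrib]
      ring
  have := hout.unique hexp
  rw [one_mul] at this
  rw [this]
  ring

lemma meromorphicOn_zetaPSp2Explicit {p q r : ℕ} (hp : 1 ≤ p) (hq : 1 ≤ q) :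
    MeromorphicOn (zetaPSp2Explicit p q r) Set.univ := by
  intro s _
  have hz : ∀ l : ℕ, MeromorphicAt (fun s => riemannZeta (s + (l : ℂ))) s := fun l =>
    meromorphicAt_comp_add (meromorphicAt_riemannZeta _)
  have hconst : ∀ j l : ℕ, MeromorphicAt (fun s => zetaFactor 1 j (s + (l : ℂ))) s := fun j l =>
    ((MeromorphicAt.const _ s).mul (hz l)).mul (MeromorphicAt.const _ s)
  have htwo : ∀ l : ℕ, MeromorphicAt (fun s : ℂ => (2 : ℂ) ^ (1 - (s + (l : ℂ))) - 1) s := by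
    intro l
    refine (Differentiable.analyticAt ?_ s).meromorphicAt
    exact (((differentiable_id.add_const _).const_sub _).const_cpow (Or.inl two_ne_zero)).sub_const _
  have hvar : ∀ j l : ℕ, MeromorphicAt
      (fun s => zetaFactor ((2 : ℂ) ^ (1 - (s + (l : ℂ))) - 1) j (s + (l : ℂ))) s := fun j l =>
    ((MeromorphicAt.const _ s).mul (hz l)).mul
      (((MeromorphicAt.const _ s).sub ((htwo l).mul (MeromorphicAt.const _ s))).div
        (MeromorphicAt.const _ s))
  rw [funext (zetaPSp2Explicit_eq (r := r) hp hq)]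
  refine MeromorphicAt.add (MeromorphicAt.add ?_ ?_) ?_ <;>
    refine MeromorphicAt.fun_sum fun k _ => (MeromorphicAt.const _ s).mul ?_
  · exact hconst _ _
  · exact hvar _ _
  · exact hconst _ _

end FunctionalRelation

/-! ### Continuation and functional relation at all regular points. -/

theorem mainTheorem4 (p q r : ℕ) (hp : 1 ≤ p) (hq : 1 ≤ q) (hr : 1 ≤ r) :
    -- each of the four functions of `s` has a meromorphic continuation to `ℂ`
    ((∃ F : ℂ → ℂ, IsMeromorphicContinuation (fun s => zetaPSp2Term p s q r) F) ∧
      (∃ F : ℂ → ℂ, IsMeromorphicContinuation (fun s => zetaPSp2Term p q s r) F) ∧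
      (∃ F : ℂ → ℂ, IsMeromorphicContinuation (fun s => zetaPSp2Term r q s p) F) ∧
      (∃ F : ℂ → ℂ, IsMeromorphicContinuation (fun s => zetaPSp2Term r s q p) F)) ∧
    -- the functional relation, at every `s` where none of the functions involved is singular
    ∀ F₁ F₂ F₃ F₄ : ℂ → ℂ,
      IsMeromorphicContinuation (fun s => zetaPSp2Term p s q r) F₁ →
      IsMeromorphicContinuation (fun s => zetaPSp2Term p q s r) F₂ →
      IsMeromorphicContinuation (fun s => zetaPSp2Term r q s p) F₃ →
      IsMeromorphicContinuation (fun s => zetaPSp2Term r s q p) F₄ →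
      ∀ s : ℂ, AnalyticAt ℂ F₁ s → AnalyticAt ℂ F₂ s → AnalyticAt ℂ F₃ s → AnalyticAt ℂ F₄ s →
        AnalyticAt ℂ (zetaPSp2Explicit p q r) s →
        F₁ s + (-1 : ℂ) ^ p * F₂ s + (-1 : ℂ) ^ (p + q) * F₃ s +
          (-1 : ℂ) ^ (p + q + r) * F₄ s + zetaPSp2Explicit p q r s = 0 := by
  refine ⟨⟨exists_continuation_left hp hq hr, exists_continuation_right hp hq hr,
    exists_continuation_right hr hq hp, exists_continuation_left hr hq hp⟩, ?_⟩
  intro F₁ F₂ F₃ F₄ h₁ h₂ h₃ h₄ s hs₁ hs₂ hs₃ hs₄ hs₅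
  have hmer : MeromorphicOn (fun s => F₁ s + (-1 : ℂ) ^ p * F₂ s + (-1 : ℂ) ^ (p + q) * F₃ s +
      (-1 : ℂ) ^ (p + q + r) * F₄ s + zetaPSp2Explicit p q r s) Set.univ := fun z hz =>
    ((((h₁.1 z hz).add ((MeromorphicAt.const _ z).mul (h₂.1 z hz))).add
      ((MeromorphicAt.const _ z).mul (h₃.1 z hz))).add
      ((MeromorphicAt.const _ z).mul (h₄.1 z hz))).add (meromorphicOn_zetaPSp2Explicit hp hq z hz)
  have hcont : ContinuousAt (fun s => F₁ s + (-1 : ℂ) ^ p * F₂ s + (-1 : ℂ) ^ (p + q) * F₃ s +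
      (-1 : ℂ) ^ (p + q + r) * F₄ s + zetaPSp2Explicit p q r s) s :=
    (((hs₁.continuousAt.add (continuousAt_const.mul hs₂.continuousAt)).add
      (continuousAt_const.mul hs₃.continuousAt)).add
      (continuousAt_const.mul hs₄.continuousAt)).add hs₅.continuousAt
  -- The half plane Re z > Re s - 1 is any one containing s; the relation holds for Re z > 1, and
  -- continuity at s turns equality near s into equality at s.
  exact eq_of_meromorphicOn (G := fun _ => 0) (σ := s.re - 1) (fun z _ => hmer z trivial)
    (fun z _ => MeromorphicAt.const 0 z)
    (fun z hz => functional_relation_of_one_lt_re hp hq hr hz (h₁.2 z hz) (h₂.2 z hz)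
      (h₃.2 z hz) (h₄.2 z hz)) (by linarith) hcont continuousAt_const
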